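/- Let $N\ge 2$ and let $\Omega\subset\mathbb R^N$ be open. Write $\omega\subset\subset\Omega$ when $\overline\omega$ is compact and contained in $\Omega$. Let $a:\Omega\times\mathbb R\times\mathbb R^N\to\mathbb R^N$, $B:\Omega\times\mathbb R\to\mathbb R$ and $F:\Omega\times\mathbb R^N\to\mathbb R$ be Carathéodory functions (measurable in $x\in\Omega$ for all values of the remaining variables, and continuous in the remaining variables for a.e. $x\in\Omega$). Suppose that: (i) there are constants $\beta\ge\alpha>0$ such that, for a.e. $x\in\Omega$, every $s\in\mathbb R$ and all $\xi,\eta\in\mathbb R^N$, $$a(x,s,\xi)\cdot\xi\ge\alpha|\xi|^2,\qquad |a(x,s,\xi)|\le\beta|\xi|,\qquad (a(x,s,\xi)-a(x,s,\eta))\cdot(\xi-\eta)>0\ \text{ if }\xi\ne\eta;$$ (ii) there are $q\in(N/2,\infty]$, $F_0\in L^q_{\rm loc}(\Omega)$ and $p_0>0$ such that $|F(x,\xi)|\le F_0(x)+p_0|\xi|$ for a.e. $x\in\Omega$ and every $\xi\in\mathbb R^N$; (iii) there is a continuous nondecreasing function $b:[0,+\infty)\to[0,+\infty)$ such that $b(s)/s$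 is nondecreasing for large $s$, such that the Keller--Osserman condition holds, i.e. there is $t_0>0$ with $\int_0^t b(s)\,ds>0$ for all $t\ge t_0$ and $$\int_{t_0}^{+\infty}\frac{dt}{\sqrt{2\int_0^t b(s)\,ds}}<+\infty,$$ and such that for every $\omega\subset\subset\Omega$ there is $m_\omega>0$ with $B(x,s)\ge m_\omega b(s)$ for a.e. $x\in\omega$ and every $s>0$. Then for every $\omega\subset\subset\Omega$ there is a constant $C_\omega>0$ such that every distributional subsolution $u\in H^1_{\rm loc}(\Omega)$ of $$-\operatorname{div}(a(x,u,\nabla u))+B(x,u)=F(x,\nabla u)\quad\text{in }\Omega$$ with $u^+=\max(u,0)\in L^\infty_{\rm loc}(\Omega)$ and $B(x,u^+)\in L^1_{\rm loc}(\Omega)$ satisfies $u(x)\le C_\omega$ for a.e. $x\in\omega$. In particular $C_\omega$ does not depend on $u$. Here $u\in H^1_{\rm loc}(\Omega)$ is called a distributional subsolution if $a(x,u,\nabla u)$, $B(x,u)$ and $F(x,\nabla u)$ are in $L^1_{\rm loc}(\Omega)$ and $$\int_\Omega a(x,u,\nabla u)\cdot\nabla\varphi\,dx+\int_\Omega B(x,u)\,\varphi\,dx\le\int_\Omega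 F(x,\nabla u)\,\varphi\,dx\qquad\text{for all }0\le\varphi\in C_c^\infty(\Omega).$$ -/

import Mathlib

open MeasureTheory Set
open TopologicalSpace (Opens)
open scoped ENNReal

noncomputable section

/-- `ℝ^N` with the Euclidean norm. -/
abbrev RN (N : ℕ) : Type := EuclideanSpace ℝ (Fin N)

/-- `ω ⊂⊂ Ω`: the closure of `ω` is compact and contained in `Ω`. -/
def CompactlyContained {N : ℕ} (ω : Set (RN N)) (Ω : Opens (RN N)) : Prop :=
  IsCompact (closure ω) ∧ closure ω ⊆ (Ω : Set (RN N))

/-- `f ∈ L^p_loc(Ω)`: `f` is in `L^p(K)` for every compact `K ⊆ Ω`. -/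
def MemLpLoc {N : ℕ} {Y : Type*} [NormedAddCommGroup Y] (Ω : Opens (RN N))
    (f : RN N → Y) (p : ℝ≥0∞) : Prop :=
  ∀ K : Set (RN N), IsCompact K → K ⊆ (Ω : Set (RN N)) → MemLp f p (volume.restrict K)

/-- `f(x, y)` is a Carathéodory function on `Ω`: (Lebesgue) measurable in `x ∈ Ω` for every `y`,
and continuous in `y` for almost every `x ∈ Ω`. -/
def IsCaratheodory {N : ℕ} {Y Z : Type*} [TopologicalSpace Y] [TopologicalSpace Z]
    [MeasurableSpace Z] (Ω : Opens (RN N)) (f : RN N → Y → Z) : Prop :=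
  (∀ y : Y, AEMeasurable (fun x => f x y) (volume.restrict (Ω : Set (RN N)))) ∧
    ∀ᵐ x ∂(volume.restrict (Ω : Set (RN N))), Continuous (f x)

/-- The Keller-Osserman condition: for some `t₀ > 0`,
`∫_{t₀}^{+∞} dt / √(2 ∫_0^t b(s) ds) < +∞`. The denominator is required to be positive, as
otherwise the division by zero would make the condition hold for an empty reason. -/
def KellerOsserman (b : ℝ → ℝ) : Prop :=
  ∃ t₀ : ℝ, 0 < t₀ ∧ (∀ t, t₀ ≤ t → 0 < ∫ s in (0 : ℝ)..t, b s) ∧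
    IntegrableOn (fun t : ℝ => 1 / √(2 * ∫ s in (0 : ℝ)..t, b s)) (Ioi t₀)

/-- `u ∈ H¹_loc(Ω)` with distributional gradient `Du`: both `u` and `Du` are in `L²_loc(Ω)` and
`∫_Ω u ∂_i φ = - ∫_Ω (Du)_i φ` for all `φ ∈ C_c^∞(Ω)` and all `i`. -/
structure MemH1Loc {N : ℕ} (Ω : Opens (RN N)) (u : RN N → ℝ) (Du : RN N → RN N) : Prop where
  memLp : MemLpLoc Ω u 2
  memLp_grad : MemLpLoc Ω Du 2
  weak_grad : ∀ (φ : TestFunction Ω ℝ ⊤) (i : Fin N),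
    ∫ x in (Ω : Set (RN N)), u x * gradient φ x i = - ∫ x in (Ω : Set (RN N)), Du x i * φ x

/-- `u`, with distributional gradient `Du`, is a distributional subsolution in `Ω` of
`-div a(x, u, ∇u) + B(x, u) = F(x, ∇u)`: all the terms are in `L¹_loc(Ω)` and
`∫_Ω a(x, u, ∇u) · ∇φ + ∫_Ω B(x, u) φ ≤ ∫_Ω F(x, ∇u) φ` for all `0 ≤ φ ∈ C_c^∞(Ω)`. -/
structure IsDistribSubsolution {N : ℕ} (Ω : Opens (RN N)) (a : RN N → ℝ → RN N → RN N)
    (B : RN N → ℝ → ℝ) (F : RN N → RN N → ℝ) (u : RN N → ℝ) (Du : RN N → RN N) : Prop where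
  memLp_a : MemLpLoc Ω (fun x => a x (u x) (Du x)) 1
  memLp_B : MemLpLoc Ω (fun x => B x (u x)) 1
  memLp_F : MemLpLoc Ω (fun x => F x (Du x)) 1
  ineq : ∀ φ : TestFunction Ω ℝ ⊤, (∀ x, 0 ≤ φ x) →
    (∫ x in (Ω : Set (RN N)), inner ℝ (a x (u x) (Du x)) (gradient φ x)) +
        ∫ x in (Ω : Set (RN N)), B x (u x) * φ x ≤
      ∫ x in (Ω : Set (RN N)), F x (Du x) * φ x

end

/-! ### Mollification and smooth approximation of `H¹_loc` functions. -/

section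

open Filter Topology ContDiff Convolution

variable {N : ℕ}

/-! The heart of the matter is a halving principle. Suppose `1 ≤ M` and `u ≤ M` on a ball of radius
`2ρ`, with `ρ ≤ 1`. Testing with a cutoff times a smooth function of `u` that vanishes below the
level `M/8` bounds `b(M/8)` times the measure of `{u > M/4}` in the ball of radius `ρ` by a constant
times `ρ^N M/ρ²`. Once `b(M/8) ρ² ≥ C₁ M`, this set fills so small a fraction of the ball that De
Giorgi iteration yields `u ≤ M/2` on the ball of radius `ρ/2` (`exists_halving_const`).

One halving thus costs a distance `2ρ` with `ρ` comparable to `√(M / b(M/8))`. Along `M = 8 · 2^n`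
the costs are multiples of `√(2^n / b(2^n))`, and these are summable: this is the dyadic form of the
Keller-Osserman condition (`KellerOsserman.summable`). Fix `n₀` so that the tail of the series is
shorter than the room around `ω` inside `Ω`. A given `u` is bounded above near `ω`, hence lies below
some high dyadic level; finitely many halvings bring it down to `4 · 2^n₀` on `ω`. Only the number
of halvings depends on `u`.

Both the absorption bound and the De Giorgi recursion (`exists_level_set_const`) come from the test
function `ζ² g((u - k)/d)`, where `g(t) = exp(-1/t)` for `t > 0` and `g = 0` otherwise. As `g` is
smooth and bounded with bounded derivative, such test functions are reached by mollifying `u`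
(`IsDistribSubsolution.integral_test_comp_le`), and the identity `g = t² g'` allows the gradient
terms to be absorbed in the coercive one (`caccioppoli_pointwise`). The `L¹` Sobolev inequality
turns the resulting energy estimate into a recursion for the measures of superlevel sets. The datum
`F₀` enters through Hölder's inequality with exponent `θ = 1 - 1/q`; the condition `q > N/2` is what
makes the recursion superlinear (`exists_degiorgi_const`). -/

theorem tendsto_integral_zero_of_dominated_tendsto {X : Type*} [MeasurableSpace X] {μ : Measure X}
    {g h : ℕ → X → ℝ} {H : X → ℝ} (hg0 : ∀ n x, 0 ≤ g n x) (hgh : ∀ n x, g n x ≤ h n x)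
    (hgm : ∀ n, AEStronglyMeasurable (g n) μ)
    (hh : ∀ n, Integrable (h n) μ) (hH : Integrable H μ) (hH0 : ∀ x, 0 ≤ H x)
    (hg : ∀ᵐ x ∂μ, Tendsto (fun n => g n x) atTop (𝓝 0))
    (hhH : ∀ᵐ x ∂μ, Tendsto (fun n => h n x) atTop (𝓝 (H x)))
    (hint : Tendsto (fun n => ∫ x, h n x ∂μ) atTop (𝓝 (∫ x, H x ∂μ))) :
    Tendsto (fun n => ∫ x, g n x ∂μ) atTop (𝓝 0) := by
  have hgi : ∀ n, Integrable (g n) μ := fun n => (hh n).mono' (hgm n)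
    (Eventually.of_forall fun x => by rw [Real.norm_of_nonneg (hg0 n x)]; exact hgh n x)
  -- The majorants `h n` vary with `n`, so both sequences are truncated at the limit `H`, and `g ≤
  -- min g H + (h - min h H)` is used. The last bracket has integral tending to zero because `∫ h n
  -- → ∫ H`.
  have h1 : Tendsto (fun n => ∫ x, min (g n x) (H x) ∂μ) atTop (𝓝 (∫ x, (0 : ℝ) ∂μ)) := by
    refine tendsto_integral_of_dominated_convergence H
      (fun n => ((hgi n).inf hH).aestronglyMeasurable) hH
      (fun n => Eventually.of_forall fun x => ?_) ?_
    · rw [Real.norm_of_nonneg (le_min (hg0 n x) (hH0 x))]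
      exact min_le_right _ _
    · filter_upwards [hg] with x hx
      have := hx.min (tendsto_const_nhds (x := H x))
      rwa [min_eq_left (hH0 x)] at this
  have h2 : Tendsto (fun n => ∫ x, min (h n x) (H x) ∂μ) atTop (𝓝 (∫ x, H x ∂μ)) := by
    refine tendsto_integral_of_dominated_convergence H
      (fun n => ((hh n).inf hH).aestronglyMeasurable) hH
      (fun n => Eventually.of_forall fun x => ?_) ?_
    · rw [Real.norm_of_nonneg (le_min ((hg0 n x).trans (hgh n x)) (hH0 x))]
      exact min_le_right _ _
    · filter_upwards [hhH] with x hx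
      simpa using hx.min (tendsto_const_nhds (x := H x))
  have h3 := (h1.add (hint.sub h2))
  simp only [integral_zero, sub_self, add_zero] at h3
  refine squeeze_zero (fun n => integral_nonneg (hg0 n)) (fun n => ?_) h3
  have e1 := integral_sub (hh n) ((hh n).inf hH)
  have e2 := integral_add ((hgi n).inf hH) ((hh n).sub ((hh n).inf hH))
  simp only [Pi.inf_apply, Pi.sub_apply] at e1 e2
  rw [← e1, ← e2]
  refine integral_mono (hgi n) (((hgi n).inf hH).add ((hh n).sub ((hh n).inf hH))) fun x => ?_
  have := hgh n x
  show g n x ≤ min (g n x) (H x) + (h n x - min (h n x) (H x))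
  rcases le_total (g n x) (H x) with h₁ | h₁ <;>
    rcases le_total (h n x) (H x) with h₂ | h₂ <;> simp only [min_eq_left, min_eq_right, *] <;> linarith

section Mollification

variable {G : Type*} [NormedAddCommGroup G] [NormedSpace ℝ G] [HasContDiffBump G]
  [FiniteDimensional ℝ G] [MeasurableSpace G] [BorelSpace G] {μ : Measure G} [μ.IsAddHaarMeasure]
  {E : Type*} [NormedAddCommGroup E] [NormedSpace ℝ E]

theorem ContDiffBump.norm_sq_convolution_le (φ : ContDiffBump (0 : G)) {f : G → E}
    (hf : LocallyIntegrable f μ) (hf2 : LocallyIntegrable (fun x => ‖f x‖ ^ 2) μ) (x : G) :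
    ‖(φ.normed μ ⋆[ContinuousLinearMap.lsmul ℝ ℝ, μ] f) x‖ ^ 2 ≤
      (φ.normed μ ⋆[ContinuousLinearMap.lsmul ℝ ℝ, μ] fun y => ‖f y‖ ^ 2) x := by
  have hc := φ.hasCompactSupport_normed (μ := μ)
  have hs : Continuous (φ.normed μ) := (φ.contDiff_normed (n := 0)).continuous
  have i1 : Integrable (fun t => φ.normed μ t * ‖f (x - t)‖) μ := by
    have := (hc.convolutionExists_left (ContinuousLinearMap.lsmul ℝ ℝ) hs hf x).norm
    simpa [norm_smul, abs_of_nonneg (φ.nonneg_normed _)] using this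
  have i2 : Integrable (fun t => φ.normed μ t * ‖f (x - t)‖ ^ 2) μ := by
    have := (hc.convolutionExists_left (ContinuousLinearMap.lsmul ℝ ℝ) hs hf2 x)
    simpa [ConvolutionExistsAt] using this
  have i0 : Integrable (fun t => φ.normed μ t) μ := φ.integrable_normed
  simp only [convolution_def, ContinuousLinearMap.lsmul_apply, smul_eq_mul]
  set c := ∫ t, φ.normed μ t * ‖f (x - t)‖ ∂μ
  have hc1 : ‖∫ t, φ.normed μ t • f (x - t) ∂μ‖ ≤ c := by
    refine (norm_integral_le_integral_norm _).trans_eq (integral_congr_ae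
      (Eventually.of_forall fun t => ?_))
    simp [norm_smul, abs_of_nonneg (φ.nonneg_normed t)]
  -- Jensen's inequality for the square: integrate `φ (c - ‖f‖)² ≥ 0`, where `c` is the mean of
  -- `‖f‖` against the unit mass `φ`.
  have hc2 : 2 * c * c ≤ c ^ 2 * 1 + ∫ t, φ.normed μ t * ‖f (x - t)‖ ^ 2 ∂μ := by
    have e : c ^ 2 * 1 + ∫ t, φ.normed μ t * ‖f (x - t)‖ ^ 2 ∂μ =
        ∫ t, (c ^ 2 * φ.normed μ t + φ.normed μ t * ‖f (x - t)‖ ^ 2) ∂μ := by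
      rw [integral_add (i0.const_mul _) i2, integral_const_mul, φ.integral_normed]
    have e' : 2 * c * c = ∫ t, 2 * c * (φ.normed μ t * ‖f (x - t)‖) ∂μ := by
      rw [integral_const_mul]
    rw [e, e']
    refine integral_mono (i1.const_mul _) ((i0.const_mul _).add i2) fun t => ?_
    have := mul_nonneg (φ.nonneg_normed (μ := μ) t) (sq_nonneg (c - ‖f (x - t)‖))
    show 2 * c * (φ.normed μ t * ‖f (x - t)‖) ≤ c ^ 2 * φ.normed μ t + φ.normed μ t * ‖f (x - t)‖ ^ 2
    nlinarith
  have : ‖∫ t, φ.normed μ t • f (x - t) ∂μ‖ ^ 2 ≤ c ^ 2 := by gcongr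
  linarith

/-- Convergence almost everywhere comes from Lebesgue differentiation. It is upgraded to `L²` with
the majorants `2 φᵢ ⋆ ‖f‖² + 2 ‖f‖²`, whose integrals do not depend on `i` since each `φᵢ` has mass
one. -/
theorem ContDiffBump.tendsto_integral_norm_sq_convolution_sub [CompleteSpace E]
    {φ : ℕ → ContDiffBump (0 : G)}
    {K : ℝ} (hφ : Tendsto (fun i => (φ i).rOut) atTop (𝓝 0))
    (hφK : ∀ i, (φ i).rOut ≤ K * (φ i).rIn) {f : G → E} (hf : MemLp f 2 μ) :
    (∀ i, Integrable (fun x =>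
        ‖((φ i).normed μ ⋆[ContinuousLinearMap.lsmul ℝ ℝ, μ] f) x - f x‖ ^ 2) μ) ∧
    Tendsto (fun i => ∫ x,
      ‖((φ i).normed μ ⋆[ContinuousLinearMap.lsmul ℝ ℝ, μ] f) x - f x‖ ^ 2 ∂μ) atTop (𝓝 0) := by
  have hfl : LocallyIntegrable f μ := hf.locallyIntegrable (by norm_num)
  have hf2 : Integrable (fun x => ‖f x‖ ^ 2) μ := hf.integrable_norm_pow (by norm_num)
  have hci : ∀ i, Integrable ((φ i).normed μ ⋆[ContinuousLinearMap.lsmul ℝ ℝ, μ]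
      fun y => ‖f y‖ ^ 2) μ := fun i => (φ i).integrable_normed.integrable_convolution _ hf2
  have hcont : ∀ i, Continuous ((φ i).normed μ ⋆[ContinuousLinearMap.lsmul ℝ ℝ, μ] f) := fun i =>
    (φ i).hasCompactSupport_normed.continuous_convolution_left _
      ((φ i).contDiff_normed (n := 0)).continuous hfl
  have hle : ∀ i x, ‖((φ i).normed μ ⋆[ContinuousLinearMap.lsmul ℝ ℝ, μ] f) x - f x‖ ^ 2 ≤
      2 * ((φ i).normed μ ⋆[ContinuousLinearMap.lsmul ℝ ℝ, μ] fun y => ‖f y‖ ^ 2) x +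
        2 * ‖f x‖ ^ 2 := fun i x => by
    have h1 := (φ i).norm_sq_convolution_le hfl hf2.locallyIntegrable x
    have h2 := norm_sub_le (((φ i).normed μ ⋆[ContinuousLinearMap.lsmul ℝ ℝ, μ] f) x) (f x)
    have h3 : ‖((φ i).normed μ ⋆[ContinuousLinearMap.lsmul ℝ ℝ, μ] f) x - f x‖ ^ 2 ≤
      (‖((φ i).normed μ ⋆[ContinuousLinearMap.lsmul ℝ ℝ, μ] f) x‖ + ‖f x‖) ^ 2 := by gcongr
    nlinarith [sq_nonneg (‖((φ i).normed μ ⋆[ContinuousLinearMap.lsmul ℝ ℝ, μ] f) x‖ - ‖f x‖)]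
  have hm : ∀ i, AEStronglyMeasurable (fun x =>
      ‖((φ i).normed μ ⋆[ContinuousLinearMap.lsmul ℝ ℝ, μ] f) x - f x‖ ^ 2) μ := fun i =>
    ((hcont i).aestronglyMeasurable.sub hf.1).norm.pow 2
  have hb : ∀ i, Integrable (fun x =>
      2 * ((φ i).normed μ ⋆[ContinuousLinearMap.lsmul ℝ ℝ, μ] fun y => ‖f y‖ ^ 2) x +
        2 * ‖f x‖ ^ 2) μ := fun i => ((hci i).const_mul 2).add (hf2.const_mul 2)
  refine ⟨fun i => (hb i).mono' (hm i) (Eventually.of_forall fun x => by simpa using hle i x), ?_⟩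
  refine tendsto_integral_zero_of_dominated_tendsto (H := fun x => 2 * ‖f x‖ ^ 2 + 2 * ‖f x‖ ^ 2)
    (fun i x => by positivity) hle hm hb ((hf2.const_mul 2).add (hf2.const_mul 2))
    (fun x => by positivity) ?_ ?_ ?_
  · filter_upwards [ContDiffBump.ae_convolution_tendsto_right_of_locallyIntegrable hφ
      (Eventually.of_forall hφK) hfl] with x hx
    have := ((hx.sub_const (f x)).norm).pow 2
    simpa using this
  · filter_upwards [ContDiffBump.ae_convolution_tendsto_right_of_locallyIntegrable hφ
      (Eventually.of_forall hφK) hf2.locallyIntegrable] with x hx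
    exact (hx.const_mul 2).add_const _
  · refine tendsto_const_nhds.congr fun i => ?_
    rw [integral_add (hf2.const_mul 2) (hf2.const_mul 2), integral_add ((hci i).const_mul 2)
      (hf2.const_mul 2), integral_const_mul, integral_const_mul,
      integral_convolution _ (φ i).integrable_normed hf2, (φ i).integral_normed]
    simp

end Mollification

theorem gradient_apply_eq_fderiv {f : RN N → ℝ} (x : RN N) (i : Fin N) :
    gradient f x i = fderiv ℝ f x (EuclideanSpace.single i 1) := by
  have h := inner_gradient_left (𝕜 := ℝ) (f := f) (x := x) (y := EuclideanSpace.single i (1 : ℝ))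
  rw [← h, EuclideanSpace.inner_single_right]
  simp

theorem MemLpLoc.indicator {Y : Type*} [NormedAddCommGroup Y] {Ω : Opens (RN N)}
    {f : RN N → Y} {p : ℝ≥0∞} (hf : MemLpLoc Ω f p) {K : Set (RN N)} (hK : IsCompact K)
    (hKΩ : K ⊆ (Ω : Set (RN N))) : MemLp (K.indicator f) p volume :=
  (memLp_indicator_iff_restrict hK.measurableSet).2 (hf K hK hKΩ)

/-- The reflected bump `y ↦ φ(x - y)` is supported in the ball around `x`, hence is an admissible
test function for the weak gradient, and it does not see the truncation of `u` and `Du` to `K`. -/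
theorem MemH1Loc.gradient_convolution {Ω : Opens (RN N)} {u : RN N → ℝ} {Du : RN N → RN N}
    (hu : MemH1Loc Ω u Du) {K : Set (RN N)} (hK : IsCompact K) (hKΩ : K ⊆ (Ω : Set (RN N)))
    (φ : ContDiffBump (0 : RN N)) {x : RN N} (hx : Metric.closedBall x φ.rOut ⊆ K) :
    gradient (φ.normed volume ⋆[ContinuousLinearMap.lsmul ℝ ℝ, volume] K.indicator u) x =
      (φ.normed volume ⋆[ContinuousLinearMap.lsmul ℝ ℝ, volume] K.indicator Du) x := by
  set ψ : RN N → ℝ := φ.normed volume with hψ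
  have hψs : ContDiff ℝ ∞ ψ := φ.contDiff_normed
  have hψc : HasCompactSupport ψ := φ.hasCompactSupport_normed
  have hψ0 : ∀ y, y ∉ Metric.closedBall x φ.rOut → ψ (x - y) = 0 := fun y hy => by
    by_contra h
    have : x - y ∈ Function.support ψ := h
    rw [hψ, φ.support_normed_eq] at this
    refine hy (Metric.ball_subset_closedBall ?_)
    rw [mem_ball_zero_iff] at this
    rwa [Metric.mem_ball, dist_comm, dist_eq_norm]
  have hψg0 : ∀ y, y ∉ Metric.closedBall x φ.rOut → fderiv ℝ ψ (x - y) = 0 := fun y hy => by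
    by_contra h
    have : x - y ∈ Function.support (fderiv ℝ ψ) := h
    have := support_fderiv_subset ℝ this
    rw [hψ, φ.tsupport_normed_eq] at this
    refine hy ?_
    rw [mem_closedBall_zero_iff] at this
    rwa [Metric.mem_closedBall, dist_comm, dist_eq_norm]
  have hui : LocallyIntegrable (K.indicator u) volume :=
    (hu.memLp.indicator hK hKΩ).locallyIntegrable (by norm_num)
  have hDi : LocallyIntegrable (K.indicator Du) volume :=
    (hu.memLp_grad.indicator hK hKΩ).locallyIntegrable (by norm_num)
  let τ : TestFunction Ω ℝ ⊤ :=
    { toFun := fun y => ψ (x - y)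
      contDiff' := hψs.comp (contDiff_const.sub contDiff_id)
      hasCompactSupport' := HasCompactSupport.intro (isCompact_closedBall x φ.rOut) hψ0
      tsupport_subset' := (closure_minimal (fun y hy => by
        by_contra h; exact hy (hψ0 y h)) Metric.isClosed_closedBall).trans (hx.trans hKΩ) }
  have hτ : ∀ y, (τ : RN N → ℝ) y = ψ (x - y) := fun y => rfl
  have hτg : ∀ y i, gradient τ y i = - fderiv ℝ ψ (x - y) (EuclideanSpace.single i 1) := by
    intro y i
    rw [gradient_apply_eq_fderiv]
    have h1 : HasFDerivAt ψ (fderiv ℝ ψ (x - y)) (x - y) :=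
      (hψs.differentiable (by simp)).differentiableAt.hasFDerivAt
    have h2 : HasFDerivAt (fun y => x - y) (-ContinuousLinearMap.id ℝ (RN N)) y :=
      (hasFDerivAt_id y).const_sub x
    have h3 : HasFDerivAt (τ : RN N → ℝ) _ y := h1.comp y h2
    rw [h3.fderiv]
    simp
  have hΩm := Ω.isOpen.measurableSet
  ext i
  rw [gradient_apply_eq_fderiv, (hψc.hasFDerivAt_convolution_left
    (ContinuousLinearMap.lsmul ℝ ℝ) (hψs.of_le (by simp)) hui x).fderiv]
  have hex1 := (hψc.fderiv ℝ).convolutionExists_left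
    ((ContinuousLinearMap.lsmul ℝ ℝ : ℝ →L[ℝ] ℝ →L[ℝ] ℝ).precompL (RN N))
    (hψs.continuous_fderiv (by simp)) hui x
  have hex2 := hψc.convolutionExists_left (ContinuousLinearMap.lsmul ℝ ℝ)
    hψs.continuous hDi x
  have e1 : (fderiv ℝ ψ ⋆[(ContinuousLinearMap.lsmul ℝ ℝ : ℝ →L[ℝ] ℝ →L[ℝ] ℝ).precompL (RN N),
      volume] K.indicator u) x (EuclideanSpace.single i 1) =
      ∫ y, fderiv ℝ ψ (x - y) (EuclideanSpace.single i 1) * K.indicator u y := by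
    rw [convolution_eq_swap, ContinuousLinearMap.integral_apply]
    · rfl
    · exact (convolutionExistsAt_iff_integrable_swap).1 hex1
  have e2 : (ψ ⋆[ContinuousLinearMap.lsmul ℝ ℝ, volume] K.indicator Du) x i =
      ∫ y, ψ (x - y) * (K.indicator Du y) i := by
    rw [convolution_eq_swap]
    have := (EuclideanSpace.proj (𝕜 := ℝ) i).integral_comp_comm
      ((convolutionExistsAt_iff_integrable_swap).1 hex2)
    exact this.symm
  rw [e1, e2]
  have e3 : ∫ y in (Ω : Set (RN N)), u y * gradient τ y i =
      - ∫ y, fderiv ℝ ψ (x - y) (EuclideanSpace.single i 1) * K.indicator u y := by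
    rw [← integral_indicator hΩm, ← integral_neg]
    congr 1 with y
    by_cases hy : y ∈ Metric.closedBall x φ.rOut
    · rw [indicator_of_mem (hKΩ (hx hy)), indicator_of_mem (hx hy), hτg]; ring
    · simp [indicator, hτg, hψg0 y hy]
  have e4 : ∫ y in (Ω : Set (RN N)), Du y i * τ y = ∫ y, ψ (x - y) * (K.indicator Du y) i := by
    rw [← integral_indicator hΩm]
    congr 1 with y
    by_cases hy : y ∈ Metric.closedBall x φ.rOut
    · rw [indicator_of_mem (hKΩ (hx hy)), indicator_of_mem (hx hy), hτ]; ring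
    · simp [indicator, hτ, hψ0 y hy]
  have := hu.weak_grad τ i
  rw [e3, e4] at this
  linarith

theorem MemH1Loc.exists_smooth_approx {Ω : Opens (RN N)} {u : RN N → ℝ} {Du : RN N → RN N}
    (hu : MemH1Loc Ω u Du) {K : Set (RN N)} (hK : IsCompact K) (hKΩ : K ⊆ (Ω : Set (RN N))) :
    ∃ v : ℕ → RN N → ℝ, (∀ n, ContDiff ℝ ∞ (v n)) ∧
      (∀ᵐ x ∂volume.restrict K, Tendsto (fun n => v n x) atTop (𝓝 (u x))) ∧
      (∀ n, MemLp (fun x => gradient (v n) x - Du x) 2 (volume.restrict K)) ∧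
      Tendsto (fun n => ∫ x in K, ‖gradient (v n) x - Du x‖ ^ 2) atTop (𝓝 0) := by
  -- Mollifying on a slightly larger compact set `L` keeps all the mollification balls centred in
  -- `K` inside `L`.
  obtain ⟨δ, hδ, hδK⟩ := hK.exists_cthickening_subset_open Ω.isOpen hKΩ
  set L := Metric.cthickening δ K with hL
  have hLc : IsCompact L := hK.cthickening
  let φ : ℕ → ContDiffBump (0 : RN N) := fun n =>
    ⟨δ / (n + 1) / 2, δ / (n + 1), by positivity, half_lt_self (by positivity)⟩
  have hφ : Tendsto (fun n => (φ n).rOut) atTop (𝓝 0) := by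
    have := (tendsto_one_div_add_atTop_nhds_zero_nat (𝕜 := ℝ)).const_mul δ
    simpa [φ, div_eq_mul_inv] using this
  have hφ2 : ∀ n, (φ n).rOut ≤ 2 * (φ n).rIn := fun n => by simp only [φ]; linarith
  have hφδ : ∀ n, (φ n).rOut ≤ δ := fun n => by
    simp only [φ]; exact div_le_self hδ.le (by linarith [n.cast_nonneg (α := ℝ)])
  have hKL : K ⊆ L := Metric.self_subset_cthickening K
  have hui := (hu.memLp.indicator hLc hδK).locallyIntegrable (by norm_num)
  have hD := hu.memLp_grad.indicator hLc hδK
  have hgrad : ∀ n, ∀ x ∈ K, gradient ((φ n).normed volume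
      ⋆[ContinuousLinearMap.lsmul ℝ ℝ, volume] L.indicator u) x =
      ((φ n).normed volume ⋆[ContinuousLinearMap.lsmul ℝ ℝ, volume] L.indicator Du) x := by
    intro n x hx
    refine hu.gradient_convolution hLc hδK (φ n) ?_
    exact (Metric.closedBall_subset_closedBall (hφδ n)).trans
      (Metric.closedBall_subset_cthickening hx δ)
  obtain ⟨hi, ht⟩ := ContDiffBump.tendsto_integral_norm_sq_convolution_sub hφ hφ2 hD
  have hcont : ∀ n, Continuous ((φ n).normed volume
      ⋆[ContinuousLinearMap.lsmul ℝ ℝ, volume] L.indicator Du) := fun n =>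
    (φ n).hasCompactSupport_normed.continuous_convolution_left _
      ((φ n).contDiff_normed (n := 0)).continuous (hD.locallyIntegrable (by norm_num))
  refine ⟨fun n => (φ n).normed volume ⋆[ContinuousLinearMap.lsmul ℝ ℝ, volume] L.indicator u,
    fun n => (φ n).hasCompactSupport_normed.contDiff_convolution_left _ (φ n).contDiff_normed hui,
    ?_, fun n => ?_, ?_⟩
  · have := ContDiffBump.ae_convolution_tendsto_right_of_locallyIntegrable hφ
      (Eventually.of_forall hφ2) hui
    filter_upwards [ae_restrict_of_ae this, ae_restrict_mem hK.measurableSet] with x hx hxK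
    rwa [indicator_of_mem (hKL hxK)] at hx
  · have h1 : MemLp (fun x => ((φ n).normed volume ⋆[ContinuousLinearMap.lsmul ℝ ℝ, volume]
        L.indicator Du) x - L.indicator Du x) 2 (volume.restrict K) := by
      refine (memLp_two_iff_integrable_sq_norm ?_).2 (hi n).integrableOn
      exact ((hcont n).aestronglyMeasurable.sub hD.1).restrict
    refine h1.ae_eq ?_
    filter_upwards [ae_restrict_mem hK.measurableSet] with x hxK
    rw [hgrad n x hxK, indicator_of_mem (hKL hxK)]
  · refine squeeze_zero (fun n => integral_nonneg fun x => by positivity) (fun n => ?_) ht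
    refine le_trans (le_of_eq ?_) (setIntegral_le_integral (s := K) (hi n)
      (Eventually.of_forall fun x => by positivity))
    refine setIntegral_congr_fun hK.measurableSet fun x hxK => ?_
    simp only
    rw [hgrad n x hxK, indicator_of_mem (hKL hxK)]

theorem tendsto_integral_norm_mul_norm_of_sq {X E E' : Type*} [MeasurableSpace X] {μ : Measure X}
    [NormedAddCommGroup E] [NormedAddCommGroup E'] {h : X → E} {w : ℕ → X → E'}
    (hh : MemLp h 2 μ) (hw : ∀ n, MemLp (w n) 2 μ)
    (hlim : Tendsto (fun n => ∫ x, ‖w n x‖ ^ 2 ∂μ) atTop (𝓝 0)) :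
    Tendsto (fun n => ∫ x, ‖h x‖ * ‖w n x‖ ∂μ) atTop (𝓝 0) := by
  have h1 : Tendsto (fun n => √(∫ x, ‖h x‖ ^ 2 ∂μ) * √(∫ x, ‖w n x‖ ^ 2 ∂μ)) atTop (𝓝 0) := by
    have := ((Real.continuous_sqrt.tendsto 0).comp hlim).const_mul (√(∫ x, ‖h x‖ ^ 2 ∂μ))
    simpa using this
  refine squeeze_zero (fun n => integral_nonneg fun x => by positivity) (fun n => ?_) h1
  have := integral_mul_norm_le_Lp_mul_Lq (μ := μ) (f := fun x => ‖h x‖) (g := fun x => ‖w n x‖)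
    (p := 2) (q := 2) Real.HolderConjugate.two_two (by simpa using hh.norm) (by simpa using (hw n).norm)
  simpa [Real.sqrt_eq_rpow] using this

theorem integrable_inner_of_memLp_two {X : Type*} [MeasurableSpace X] {μ : Measure X}
    {f g : X → RN N} (hf : MemLp f 2 μ) (hg : MemLp g 2 μ) :
    Integrable (fun x => (inner ℝ (f x) (g x) : ℝ)) μ :=
  (hf.norm.integrable_mul hg.norm).mono' (hf.1.inner hg.1)
    (Eventually.of_forall fun _ => norm_inner_le_norm _ _)

theorem gradient_mul_comp {η v : RN N → ℝ} {G : ℝ → ℝ} (hη : ContDiff ℝ ∞ η)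
    (hv : ContDiff ℝ ∞ v) (hG : ContDiff ℝ ∞ G) (x : RN N) :
    gradient (fun x => η x * G (v x)) x =
      (η x * deriv G (v x)) • gradient v x + G (v x) • gradient η x := by
  have h1 : HasFDerivAt η (fderiv ℝ η x) x :=
    (hη.differentiable (by simp)).differentiableAt.hasFDerivAt
  have h2 : HasFDerivAt v (fderiv ℝ v x) x :=
    (hv.differentiable (by simp)).differentiableAt.hasFDerivAt
  have h3 : HasDerivAt G (deriv G (v x)) (v x) :=
    (hG.differentiable (by simp)).differentiableAt.hasDerivAt
  have h4 := h1.mul (h3.comp_hasFDerivAt x h2)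
  ext i
  simp only [PiLp.add_apply, PiLp.smul_apply, gradient_apply_eq_fderiv, smul_eq_mul]
  erw [h4.fderiv]
  simp
  ring

theorem gradient_eq_zero_of_notMem_tsupport {f : RN N → ℝ} {x : RN N} (hx : x ∉ tsupport f) :
    gradient f x = 0 := by
  have : fderiv ℝ f x = 0 := by
    by_contra h
    exact hx (support_fderiv_subset ℝ h)
  simp [gradient, this]

theorem continuous_gradient {f : RN N → ℝ} (hf : ContDiff ℝ ∞ f) : Continuous (gradient f) :=
  (InnerProductSpace.toDual ℝ (RN N)).symm.continuous.comp (hf.continuous_fderiv (by simp))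

theorem exists_norm_gradient_le {f : RN N → ℝ} (hf : ContDiff ℝ ∞ f) (hc : HasCompactSupport f) :
    ∃ C, ∀ x, ‖gradient f x‖ ≤ C :=
  (continuous_gradient hf).bounded_above_of_compact_support <|
    HasCompactSupport.intro hc fun _ hx => gradient_eq_zero_of_notMem_tsupport hx

/-! ### Nonlinear test functions of `u` and the Sobolev inequality for them. -/

section Limits

variable {Ω : Opens (RN N)} {u : RN N → ℝ} {Du : RN N → RN N} {K : Set (RN N)}
  {η : RN N → ℝ} {G : ℝ → ℝ} {L : ℝ}

/-- The inequality is tested with `η G(v n)`, where `v n` mollifies `u`; no chain rule for `u`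
itself is needed. Square integrability of the flux matches the `L²` convergence of the gradients,
and the terms in `B` and `F`, which are only `L¹`, pass to the limit because `G` is bounded. -/
theorem IsDistribSubsolution.integral_test_comp_le {a : RN N → ℝ → RN N → RN N}
    {B : RN N → ℝ → ℝ} {F : RN N → RN N → ℝ}
    (hsub : IsDistribSubsolution Ω a B F u Du) (hu : MemH1Loc Ω u Du)
    (hK : IsCompact K) (hKΩ : K ⊆ (Ω : Set (RN N)))
    (ha : MemLp (fun x => a x (u x) (Du x)) 2 (volume.restrict K))
    (hη : ContDiff ℝ ∞ η) (hηK : tsupport η ⊆ K) (hη0 : ∀ x, 0 ≤ η x)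
    (hG : ContDiff ℝ ∞ G) (hG0 : ∀ s, 0 ≤ G s) (hG1 : ∀ s, G s ≤ 1) (hGL : ∀ s, |deriv G s| ≤ L) :
    (∫ x in K, (η x * deriv G (u x) * inner ℝ (a x (u x) (Du x)) (Du x) +
      G (u x) * inner ℝ (a x (u x) (Du x)) (gradient η x))) + ∫ x in K, B x (u x) * (η x * G (u x))
      ≤ ∫ x in K, F x (Du x) * (η x * G (u x)) := by
  obtain ⟨v, hv, hvu, hvD, hvlim⟩ := hu.exists_smooth_approx hK hKΩ
  have hηc : HasCompactSupport η := hK.of_isClosed_subset (isClosed_tsupport η) hηK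
  obtain ⟨c₀, hc₀⟩ := hη.continuous.bounded_above_of_compact_support hηc
  obtain ⟨c₁, hc₁⟩ := exists_norm_gradient_le hη hηc
  have hc₀0 : 0 ≤ c₀ := (norm_nonneg _).trans (hc₀ 0)
  have hc₁0 : 0 ≤ c₁ := (norm_nonneg _).trans (hc₁ 0)
  have hL0 : 0 ≤ L := (abs_nonneg _).trans (hGL 0)
  have hDm := hu.memLp_grad K hK hKΩ
  have hdG : Continuous (deriv G) := hG.continuous_deriv (by simp)
  have hgη := continuous_gradient hη
  have hηx : ∀ x, x ∉ K → η x = 0 := fun x hx => image_eq_zero_of_notMem_tsupport fun h => hx (hηK h)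
  have hηgx : ∀ x, x ∉ K → gradient η x = 0 := fun x hx =>
    gradient_eq_zero_of_notMem_tsupport fun h => hx (hηK h)
  set A : RN N → RN N := fun x => a x (u x) (Du x) with hA
  have hBi : Integrable (fun x => B x (u x)) (volume.restrict K) :=
    memLp_one_iff_integrable.1 (hsub.memLp_B K hK hKΩ)
  have hFi : Integrable (fun x => F x (Du x)) (volume.restrict K) :=
    memLp_one_iff_integrable.1 (hsub.memLp_F K hK hKΩ)
  have : IsFiniteMeasure (volume.restrict K) := ⟨by simpa using hK.measure_lt_top⟩
  have hAi : Integrable A (volume.restrict K) := ha.integrable (by norm_num)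
  have hAD : Integrable (fun x => ‖A x‖ * ‖Du x‖) (volume.restrict K) :=
    ha.norm.integrable_mul hDm.norm
  have hΩm := Ω.isOpen.measurableSet
  -- Writing `∇(v n) = Du + (∇(v n) - Du)` isolates an error that vanishes by Cauchy-Schwarz;
  -- dominated convergence handles the rest.
  have key : ∀ n, (∫ x in K, η x * deriv G (v n x) * inner ℝ (A x) (gradient (v n) x - Du x)) +
      (∫ x in K, (η x * deriv G (v n x) * inner ℝ (A x) (Du x) +
        G (v n x) * inner ℝ (A x) (gradient η x))) + (∫ x in K, B x (u x) * (η x * G (v n x)))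
      ≤ ∫ x in K, F x (Du x) * (η x * G (v n x)) := by
    intro n
    let τ : TestFunction Ω ℝ ⊤ :=
      { toFun := fun x => η x * G (v n x)
        contDiff' := hη.mul (hG.comp (hv n))
        hasCompactSupport' := hηc.mul_right
        tsupport_subset' := (tsupport_mul_subset_left).trans (hηK.trans hKΩ) }
    have hτ : ∀ x, (τ : RN N → ℝ) x = η x * G (v n x) := fun x => rfl
    have hτg : ∀ x, gradient τ x =
        (η x * deriv G (v n x)) • gradient (v n) x + G (v n x) • gradient η x := fun x =>
      gradient_mul_comp hη (hv n) hG x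
    have h := hsub.ineq τ fun x => mul_nonneg (hη0 x) (hG0 _)
    rw [setIntegral_eq_of_subset_of_forall_sdiff_eq_zero hΩm hKΩ
        (f := fun x => inner ℝ (a x (u x) (Du x)) (gradient τ x))
        (fun x hx => by simp [hτg, hηx x hx.2, hηgx x hx.2]),
      setIntegral_eq_of_subset_of_forall_sdiff_eq_zero hΩm hKΩ
        (f := fun x => B x (u x) * τ x) (fun x hx => by simp [hτ, hηx x hx.2]),
      setIntegral_eq_of_subset_of_forall_sdiff_eq_zero hΩm hKΩ
        (f := fun x => F x (Du x) * τ x) (fun x hx => by simp [hτ, hηx x hx.2])] at h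
    simp only [hτ, hτg] at h
    have i1 : Integrable (fun x => η x * deriv G (v n x) *
        inner ℝ (A x) (gradient (v n) x - Du x)) (volume.restrict K) := by
      refine Integrable.bdd_mul (c := c₀ * L) (integrable_inner_of_memLp_two ha (hvD n)) ?_ ?_
      · exact (hη.continuous.mul (hdG.comp (hv n).continuous)).aestronglyMeasurable
      · refine Eventually.of_forall fun x => ?_
        rw [norm_mul]
        exact mul_le_mul (hc₀ x) (hGL _) (norm_nonneg _) hc₀0
    have i2 : Integrable (fun x => η x * deriv G (v n x) * inner ℝ (A x) (Du x) +
        G (v n x) * inner ℝ (A x) (gradient η x)) (volume.restrict K) := by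
      refine Integrable.add (Integrable.bdd_mul (c := c₀ * L) (integrable_inner_of_memLp_two ha hDm) ?_ ?_)
        (Integrable.bdd_mul (c := 1) ?_ ?_ ?_)
      · exact (hη.continuous.mul (hdG.comp (hv n).continuous)).aestronglyMeasurable
      · refine Eventually.of_forall fun x => ?_
        rw [norm_mul]
        exact mul_le_mul (hc₀ x) (hGL _) (norm_nonneg _) hc₀0
      · refine (hAi.norm.mul_const c₁).mono' (hAi.1.inner hgη.aestronglyMeasurable) ?_
        refine Eventually.of_forall fun x => (norm_inner_le_norm _ _).trans ?_
        exact mul_le_mul_of_nonneg_left (hc₁ x) (norm_nonneg _)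
      · exact (hG.continuous.comp (hv n).continuous).aestronglyMeasurable
      · exact Eventually.of_forall fun x => by
          rw [Real.norm_of_nonneg (hG0 _)]; exact hG1 _
    rw [← integral_add i1 i2]
    refine le_trans (le_of_eq ?_) h
    congr 2 with x
    simp only [hA, inner_add_right, inner_smul_right, inner_sub_right]
    ring
  have l1 : Tendsto (fun n => ∫ x in K, η x * deriv G (v n x) *
      inner ℝ (A x) (gradient (v n) x - Du x)) atTop (𝓝 0) := by
    have h := (tendsto_integral_norm_mul_norm_of_sq ha hvD hvlim).const_mul (c₀ * L)
    rw [mul_zero] at h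
    refine squeeze_zero_norm (fun n => ?_) h
    rw [← integral_const_mul]
    refine norm_integral_le_of_norm_le ((ha.norm.integrable_mul (hvD n).norm).const_mul _) ?_
    refine Eventually.of_forall fun x => ?_
    rw [norm_mul, norm_mul]
    exact mul_le_mul (mul_le_mul (hc₀ x) (hGL _) (norm_nonneg _) hc₀0) (norm_inner_le_norm _ _)
      (norm_nonneg _) (by positivity)
  have l2 : Tendsto (fun n => ∫ x in K, (η x * deriv G (v n x) * inner ℝ (A x) (Du x) +
        G (v n x) * inner ℝ (A x) (gradient η x))) atTop
      (𝓝 (∫ x in K, (η x * deriv G (u x) * inner ℝ (A x) (Du x) +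
        G (u x) * inner ℝ (A x) (gradient η x)))) := by
    refine tendsto_integral_of_dominated_convergence
      (fun x => c₀ * L * (‖A x‖ * ‖Du x‖) + 1 * (‖A x‖ * c₁)) (fun n => ?_)
      ((hAD.const_mul _).add ((hAi.norm.mul_const c₁).const_mul 1))
      (fun n => Eventually.of_forall fun x => ?_) ?_
    · exact ((hη.continuous.mul (hdG.comp (hv n).continuous)).aestronglyMeasurable.mul
        (ha.1.inner hDm.1)).add ((hG.continuous.comp (hv n).continuous).aestronglyMeasurable.mul
        (ha.1.inner hgη.aestronglyMeasurable))
    · refine (norm_add_le _ _).trans (add_le_add ?_ ?_)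
      · rw [norm_mul, norm_mul]
        exact mul_le_mul (mul_le_mul (hc₀ x) (hGL _) (norm_nonneg _) hc₀0)
          (norm_inner_le_norm _ _) (norm_nonneg _) (by positivity)
      · rw [norm_mul, Real.norm_of_nonneg (hG0 _)]
        refine mul_le_mul (hG1 _) ((norm_inner_le_norm _ _).trans ?_) (norm_nonneg _) zero_le_one
        exact mul_le_mul_of_nonneg_left (hc₁ x) (norm_nonneg _)
    · filter_upwards [hvu] with x hx
      exact ((((hdG.tendsto _).comp hx).const_mul _).mul_const _).add
        (((hG.continuous.tendsto _).comp hx).mul_const _)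
  have l3 : ∀ f : RN N → ℝ, Integrable f (volume.restrict K) →
      Tendsto (fun n => ∫ x in K, f x * (η x * G (v n x))) atTop
      (𝓝 (∫ x in K, f x * (η x * G (u x)))) := by
    intro f hf
    refine tendsto_integral_of_dominated_convergence (fun x => ‖f x‖ * c₀) (fun n => ?_)
      (hf.norm.mul_const _) (fun n => Eventually.of_forall fun x => ?_) ?_
    · exact hf.1.mul (hη.continuous.mul (hG.continuous.comp (hv n).continuous)).aestronglyMeasurable
    · rw [norm_mul, norm_mul, Real.norm_of_nonneg (hG0 _)]
      refine mul_le_mul_of_nonneg_left ?_ (norm_nonneg _)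
      exact (mul_le_mul (hc₀ x) (hG1 _) (hG0 _) hc₀0).trans_eq (mul_one _)
    · filter_upwards [hvu] with x hx
      exact (((hG.continuous.tendsto _).comp hx).const_mul _).const_mul _
  have h := le_of_tendsto_of_tendsto' ((l1.add l2).add (l3 _ hBi)) (l3 _ hFi) key
  simpa using h

/-- The Gagliardo-Nirenberg-Sobolev inequality for `η G(v n)` passes to the limit: Fatou's lemma on
the left, `L¹` convergence of the gradients on the right. -/
theorem MemH1Loc.lintegral_pow_comp_le (hN : 2 ≤ N) (hu : MemH1Loc Ω u Du)
    (hK : IsCompact K) (hKΩ : K ⊆ (Ω : Set (RN N)))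
    (hη : ContDiff ℝ ∞ η) (hηK : tsupport η ⊆ K)
    (hG : ContDiff ℝ ∞ G) (hG0 : ∀ s, 0 ≤ G s) (hG1 : ∀ s, G s ≤ 1) (hGL : ∀ s, |deriv G s| ≤ L) :
    ∫⁻ x in K, ‖η x * G (u x)‖ₑ ^ ((N : ℝ).conjExponent) ≤
      lintegralPowLePowLIntegralFDerivConst (volume : Measure (RN N)) ((N : ℝ).conjExponent) *
        (ENNReal.ofReal (∫ x in K, ‖(η x * deriv G (u x)) • Du x + G (u x) • gradient η x‖)) ^
          ((N : ℝ).conjExponent) := by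
  obtain ⟨v, hv, hvu, hvD, hvlim⟩ := hu.exists_smooth_approx hK hKΩ
  have hηc : HasCompactSupport η := hK.of_isClosed_subset (isClosed_tsupport η) hηK
  obtain ⟨c₀, hc₀⟩ := hη.continuous.bounded_above_of_compact_support hηc
  obtain ⟨c₁, hc₁⟩ := exists_norm_gradient_le hη hηc
  have hc₀0 : 0 ≤ c₀ := (norm_nonneg _).trans (hc₀ 0)
  have hc₁0 : 0 ≤ c₁ := (norm_nonneg _).trans (hc₁ 0)
  have hL0 : 0 ≤ L := (abs_nonneg _).trans (hGL 0)
  have hDm := hu.memLp_grad K hK hKΩ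
  have hdG : Continuous (deriv G) := hG.continuous_deriv (by simp)
  have hgη := continuous_gradient hη
  have : IsFiniteMeasure (volume.restrict K) := ⟨by simpa using hK.measure_lt_top⟩
  have hDi : Integrable Du (volume.restrict K) := hDm.integrable (by norm_num)
  set p := (N : ℝ).conjExponent with hp
  have hN1 : (1 : ℝ) < N := by exact_mod_cast hN
  have hpN : Real.HolderConjugate (N : ℝ) p := Real.HolderConjugate.conjExponent hN1
  have hp0 : 0 ≤ p := hpN.symm.pos.le
  set w : ℕ → RN N → RN N := fun n x =>
    (η x * deriv G (v n x)) • Du x + G (v n x) • gradient η x with hw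
  have hwm : ∀ n, AEStronglyMeasurable (w n) (volume.restrict K) := fun n =>
    (((hη.continuous.mul (hdG.comp (hv n).continuous)).aestronglyMeasurable.smul hDm.1).add
      ((hG.continuous.comp (hv n).continuous).smul hgη).aestronglyMeasurable)
  have hwb : ∀ n x, ‖w n x‖ ≤ c₀ * L * ‖Du x‖ + 1 * c₁ := fun n x => by
    refine (norm_add_le _ _).trans (add_le_add ?_ ?_)
    · rw [norm_smul, norm_mul]
      exact mul_le_mul_of_nonneg_right (mul_le_mul (hc₀ x) (hGL _) (norm_nonneg _) hc₀0)
        (norm_nonneg _)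
    · rw [norm_smul, Real.norm_of_nonneg (hG0 _)]
      exact mul_le_mul (hG1 _) (hc₁ x) (norm_nonneg _) zero_le_one
  have hbi : Integrable (fun x => c₀ * L * ‖Du x‖ + 1 * c₁) (volume.restrict K) :=
    (hDi.norm.const_mul _).add (integrable_const _)
  have hwi : ∀ n, Integrable (w n) (volume.restrict K) := fun n =>
    hbi.mono' (hwm n) (Eventually.of_forall (hwb n))
  have l1 : Tendsto (fun n => ∫ x in K, ‖w n x‖) atTop
      (𝓝 (∫ x in K, ‖(η x * deriv G (u x)) • Du x + G (u x) • gradient η x‖)) := by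
    refine tendsto_integral_of_dominated_convergence _ (fun n => (hwm n).norm) hbi
      (fun n => Eventually.of_forall fun x => ?_) ?_
    · rw [norm_norm]; exact hwb n x
    · filter_upwards [hvu] with x hx
      exact (((((hdG.tendsto _).comp hx).const_mul _).smul_const _).add
        (((hG.continuous.tendsto _).comp hx).smul_const _)).norm
  have l2 : Tendsto (fun n => ∫ x in K, ‖gradient (v n) x - Du x‖) atTop (𝓝 0) := by
    have := tendsto_integral_norm_mul_norm_of_sq (memLp_const (1 : ℝ) (μ := volume.restrict K))
      hvD hvlim
    simpa using this
  have l3 := (l2.const_mul (c₀ * L)).add l1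
  rw [mul_zero, zero_add] at l3
  have l4 := ENNReal.Tendsto.const_mul
    (a := (lintegralPowLePowLIntegralFDerivConst (volume : Measure (RN N)) p : ℝ≥0∞))
    (((ENNReal.continuous_rpow_const (y := p)).tendsto _).comp
      ((ENNReal.continuous_ofReal.tendsto _).comp l3)) (Or.inr ENNReal.coe_ne_top)
  have hfat : ∫⁻ x in K, ‖η x * G (u x)‖ₑ ^ p ≤
      liminf (fun n => ∫⁻ x in K, ‖η x * G (v n x)‖ₑ ^ p) atTop := by
    refine le_trans (lintegral_mono_ae ?_) (lintegral_liminf_le' fun n => ?_)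
    · filter_upwards [hvu] with x hx
      have : Tendsto (fun n => ‖η x * G (v n x)‖ₑ ^ p) atTop (𝓝 (‖η x * G (u x)‖ₑ ^ p)) :=
        ((ENNReal.continuous_rpow_const (y := p)).tendsto _).comp
          ((continuous_enorm.tendsto _).comp (((hG.continuous.tendsto _).comp hx).const_mul _))
      exact this.liminf_eq.ge
    · exact ((ENNReal.continuous_rpow_const (y := p)).comp (hη.continuous.mul
        (hG.continuous.comp (hv n).continuous)).enorm).aemeasurable
  refine hfat.trans (le_trans (liminf_le_liminf (Eventually.of_forall fun n => ?_)) l4.liminf_eq.le)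
  have hcd : ContDiff ℝ ∞ (fun x => η x * G (v n x)) := hη.mul (hG.comp (hv n))
  refine (setLIntegral_le_lintegral K _).trans ((lintegral_pow_le_pow_lintegral_fderiv volume
    (hcd.of_le (by simp)) hηc.mul_right (p := p) (by simpa using hpN)).trans ?_)
  refine mul_le_mul_right (ENNReal.rpow_le_rpow ?_ hp0) _
  have e1 : ∫⁻ x, ‖fderiv ℝ (fun x => η x * G (v n x)) x‖ₑ =
      ∫⁻ x in K, ‖gradient (fun x => η x * G (v n x)) x‖ₑ := by
    rw [← lintegral_indicator hK.measurableSet]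
    congr 1 with x
    by_cases hx : x ∈ K
    · rw [indicator_of_mem hx, ← toDual_gradient (𝕜 := ℝ), ← ofReal_norm, ← ofReal_norm,
        LinearIsometryEquiv.norm_map]
    · have hx' : x ∉ tsupport (fun x => η x * G (v n x)) := fun h =>
        hx (hηK (tsupport_mul_subset_left h))
      rw [indicator_of_notMem hx, ← toDual_gradient (𝕜 := ℝ), ← ofReal_norm,
        LinearIsometryEquiv.norm_map, gradient_eq_zero_of_notMem_tsupport hx', norm_zero,
        ENNReal.ofReal_zero]
  have hgi : Integrable (fun x => c₀ * L * ‖gradient (v n) x - Du x‖) (volume.restrict K) :=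
    (((hvD n).integrable (by norm_num)).norm).const_mul _
  rw [e1, Function.comp_apply, ← integral_const_mul, ← integral_add hgi (hwi n).norm,
    ofReal_integral_eq_lintegral_ofReal
      (f := fun x => c₀ * L * ‖gradient (v n) x - Du x‖ + ‖w n x‖) (hgi.add (hwi n).norm)
      (Eventually.of_forall fun x => by positivity)]
  refine lintegral_mono fun x => ?_
  rw [← ofReal_norm]
  refine ENNReal.ofReal_le_ofReal ?_
  rw [gradient_mul_comp hη (hv n) hG]
  have e2 : (η x * deriv G (v n x)) • gradient (v n) x + G (v n x) • gradient η x =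
      (η x * deriv G (v n x)) • (gradient (v n) x - Du x) + w n x := by
    simp only [hw, smul_sub]; abel
  rw [e2]
  refine (norm_add_le _ _).trans (add_le_add_left ?_ _)
  rw [norm_smul, norm_mul]
  exact mul_le_mul_of_nonneg_right (mul_le_mul (hc₀ x) (hGL _) (norm_nonneg _) hc₀0) (norm_nonneg _)

end Limits

/-! ### The truncation profile `exp(-1/t)` and cutoff functions. -/

namespace expNegInvGlue

theorem deriv_eq (t : ℝ) : deriv expNegInvGlue t = expNegInvGlue t / t ^ 2 := by
  have h := hasDerivAt_polynomial_eval_inv_mul 1 t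
  simp only [Polynomial.eval_one, one_mul] at h
  rw [h.deriv]
  simp
  ring

theorem le_one (t : ℝ) : expNegInvGlue t ≤ 1 := by
  unfold expNegInvGlue
  split_ifs with h
  · exact zero_le_one
  · exact Real.exp_le_one_iff.2 (neg_nonpos.2 (inv_nonneg.2 (not_le.1 h).le))

theorem deriv_nonneg (t : ℝ) : 0 ≤ deriv expNegInvGlue t := by
  rw [deriv_eq]
  exact div_nonneg (expNegInvGlue.nonneg t) (sq_nonneg t)

theorem deriv_le_one (t : ℝ) : deriv expNegInvGlue t ≤ 1 := by
  rw [deriv_eq]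
  rcases le_or_gt t 0 with h | h
  · simp [zero_of_nonpos h]
  · rw [div_le_one (by positivity), expNegInvGlue, if_neg h.not_ge, Real.exp_neg,
      inv_le_comm₀ (Real.exp_pos _) (by positivity)]
    -- With `s = 1/(2t)`, the bounds `exp s ≥ e s` and `e > 2` give `exp(1/(2t)) ≥ 1/t`; squaring
    -- gives `exp(1/t) ≥ 1/t²`.
    have h1 := Real.add_one_le_exp (t⁻¹ / 2 - 1)
    have h2 : Real.exp (t⁻¹ / 2) = Real.exp (t⁻¹ / 2 - 1) * Real.exp 1 := by
      rw [← Real.exp_add]; ring_nf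
    have h3 := Real.exp_one_gt_d9
    have h4 : 0 < t⁻¹ := inv_pos.2 h
    have h5 : t⁻¹ ≤ Real.exp (t⁻¹ / 2) := by
      rw [h2]; nlinarith
    have h6 : Real.exp t⁻¹ = Real.exp (t⁻¹ / 2) ^ 2 := by
      rw [← Real.exp_nat_mul]; ring_nf
    rw [h6, ← inv_pow]
    gcongr

theorem exp_neg_one_le {t : ℝ} (ht : 1 ≤ t) : Real.exp (-1) ≤ expNegInvGlue t := by
  have := expNegInvGlue.monotone ht
  simpa [expNegInvGlue, show ¬ (1 : ℝ) ≤ 0 by norm_num] using this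

end expNegInvGlue

/-- The cutoff is `g` composed with `(r² - |x - x₀|²)/(r² - r'²)`, which is at least `1` on the
inner ball. A lower bound `e⁻¹` there serves as well as a plateau at `1`. The gradient bound is
`2r/(r² - r'²) ≤ 2/(r - r')`. -/
theorem exists_smooth_cutoff (x₀ : RN N) {r' r : ℝ} (hr' : 0 < r') (hr : r' < r) :
    ∃ ζ : RN N → ℝ, ContDiff ℝ ∞ ζ ∧ (∀ x, 0 ≤ ζ x) ∧ (∀ x, ζ x ≤ 1) ∧
      tsupport ζ ⊆ Metric.closedBall x₀ r ∧ (∀ x, ‖gradient ζ x‖ ≤ 2 / (r - r')) ∧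
      ∀ x ∈ Metric.closedBall x₀ r', Real.exp (-1) ≤ ζ x := by
  have hd : 0 < r ^ 2 - r' ^ 2 := by nlinarith
  have hr0 : 0 < r := hr'.trans hr
  set ρ : RN N → ℝ := fun x => (r ^ 2 - ‖x - x₀‖ ^ 2) / (r ^ 2 - r' ^ 2) with hρ
  have hρs : ContDiff ℝ ∞ ρ :=
    (contDiff_const.sub ((contDiff_id.sub contDiff_const).norm_sq ℝ)).div_const _
  have hneg : ∀ x, x ∉ Metric.closedBall x₀ r → ρ x ≤ 0 := fun x hx => by
    rw [mem_closedBall_iff_norm, not_le] at hx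
    exact div_nonpos_of_nonpos_of_nonneg (by nlinarith) hd.le
  refine ⟨fun x => expNegInvGlue (ρ x), expNegInvGlue.contDiff.comp hρs,
    fun x => expNegInvGlue.nonneg _, fun x => expNegInvGlue.le_one _, ?_, fun x => ?_, fun x hx => ?_⟩
  · refine closure_minimal (fun x hx => ?_) Metric.isClosed_closedBall
    by_contra h
    exact hx (expNegInvGlue.zero_of_nonpos (hneg x h))
  · have hρd : HasFDerivAt ρ ((r ^ 2 - r' ^ 2)⁻¹ • (-(2 • (innerSL ℝ (x - x₀))) : RN N →L[ℝ] ℝ)) x := by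
      have h1 : HasFDerivAt (fun y => ‖y - x₀‖ ^ 2) (2 • (innerSL ℝ (x - x₀))) x := by
        have := ((hasFDerivAt_id x).sub_const x₀).norm_sq
        simpa using this
      have h2 := (h1.const_sub (r ^ 2)).const_smul (r ^ 2 - r' ^ 2)⁻¹
      refine h2.congr_of_eventuallyEq (Eventually.of_forall fun y => ?_)
      simp [hρ, div_eq_inv_mul]
    have hg : HasDerivAt expNegInvGlue (deriv expNegInvGlue (ρ x)) (ρ x) :=
      (expNegInvGlue.contDiff (n := ⊤)).differentiable (by simp) |>.differentiableAt.hasDerivAt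
    have hc := hg.comp_hasFDerivAt x hρd
    have hn : ‖gradient (fun x => expNegInvGlue (ρ x)) x‖ =
        ‖fderiv ℝ (fun x => expNegInvGlue (ρ x)) x‖ := by
      rw [← toDual_gradient (𝕜 := ℝ), LinearIsometryEquiv.norm_map]
    have hc' : HasFDerivAt (fun x => expNegInvGlue (ρ x)) _ x := hc
    rw [hn, hc'.fderiv, norm_smul, norm_smul, norm_neg, Real.norm_of_nonneg
      (expNegInvGlue.deriv_nonneg _), Real.norm_of_nonneg (inv_nonneg.2 hd.le)]
    have hb : ‖(2 • (innerSL ℝ (x - x₀)) : RN N →L[ℝ] ℝ)‖ ≤ 2 * ‖x - x₀‖ := by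
      refine (norm_nsmul_le).trans ?_
      rw [innerSL_apply_norm]; simp
    by_cases hx : x ∈ Metric.closedBall x₀ r
    · rw [mem_closedBall_iff_norm] at hx
      have h1 : deriv expNegInvGlue (ρ x) * ((r ^ 2 - r' ^ 2)⁻¹ *
          ‖(2 • (innerSL ℝ (x - x₀)) : RN N →L[ℝ] ℝ)‖) ≤ 1 * ((r ^ 2 - r' ^ 2)⁻¹ * (2 * r)) := by
        refine mul_le_mul (expNegInvGlue.deriv_le_one _) ?_ (by positivity) zero_le_one
        exact mul_le_mul_of_nonneg_left (hb.trans (by linarith)) (by positivity)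
      refine h1.trans ?_
      rw [one_mul, inv_mul_eq_div, div_le_div_iff₀ hd (by linarith)]
      nlinarith [mul_pos hr' (sub_pos.2 hr)]
    · rw [expNegInvGlue.deriv_eq, expNegInvGlue.zero_of_nonpos (hneg x hx)]
      simp only [zero_div, zero_mul]
      exact div_nonneg zero_le_two (by linarith)
  · refine expNegInvGlue.exp_neg_one_le ?_
    rw [mem_closedBall_iff_norm] at hx
    rw [hρ, one_le_div hd]
    nlinarith [norm_nonneg (x - x₀)]

/-! ### The Caccioppoli inequality with absorption. -/

/-- Half of the coercive term, which carries `g'/d`, absorbs the terms linear in the gradient, which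
carry `g`. This works because `g = t² g'` with `t = (u - k)/d ≤ M/d`, so that `g²/g' = t² g` is
controlled by `(M/d)² g`. -/
theorem caccioppoli_pointwise {α β m f p₀ k d M u bk D z Z I₁ I₂ Bx Fx : ℝ} (hα : 0 < α)
    (hβ : 0 ≤ β) (hp₀ : 0 ≤ p₀) (hk : 0 ≤ k) (hd : 0 < d) (huM : u ≤ M) (hD : 0 ≤ D) (hz : 0 ≤ z)
    (hZ : 0 ≤ Z) (hI₁ : α * D ^ 2 ≤ I₁) (hI₂ : -(β * D * Z) ≤ I₂) (hB : k < u → m * bk ≤ Bx)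
    (hF : Fx ≤ f + p₀ * D) :
    α / (2 * d) * (deriv expNegInvGlue ((u - k) / d) * z ^ 2 * D ^ 2) +
        m * bk * (expNegInvGlue ((u - k) / d) * z ^ 2) ≤
      (z ^ 2 * (deriv expNegInvGlue ((u - k) / d) / d) * I₁ +
        expNegInvGlue ((u - k) / d) * (2 * z * I₂)) +
        Bx * (z ^ 2 * expNegInvGlue ((u - k) / d)) - Fx * (z ^ 2 * expNegInvGlue ((u - k) / d)) +
      f * (z ^ 2 * expNegInvGlue ((u - k) / d)) +
      M ^ 2 / (2 * α * d) * (expNegInvGlue ((u - k) / d) * (p₀ * z + 2 * β * Z) ^ 2) := by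
  rcases le_or_gt u k with h | h
  · have : (u - k) / d ≤ 0 := div_nonpos_of_nonpos_of_nonneg (by linarith) hd.le
    simp [expNegInvGlue.deriv_eq, expNegInvGlue.zero_of_nonpos this]
  · set t := (u - k) / d with ht
    have ht0 : 0 < t := div_pos (by linarith) hd
    have htM : t * d ≤ M := by rw [ht, div_mul_cancel₀ _ hd.ne']; linarith
    set g₁ := deriv expNegInvGlue t with hg₁
    have hg₁0 : 0 ≤ g₁ := expNegInvGlue.deriv_nonneg t
    have hg : expNegInvGlue t = t ^ 2 * g₁ := by
      rw [hg₁, expNegInvGlue.deriv_eq]; field_simp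
    rw [hg]
    set X := p₀ * z + 2 * β * Z with hX
    have hX0 : 0 ≤ X := by positivity
    have h1 : z ^ 2 * (g₁ / d) * (α * D ^ 2) ≤ z ^ 2 * (g₁ / d) * I₁ := by gcongr
    have h2 : t ^ 2 * g₁ * (2 * z * -(β * D * Z)) ≤ t ^ 2 * g₁ * (2 * z * I₂) := by gcongr
    have h3 : m * bk * (z ^ 2 * (t ^ 2 * g₁)) ≤ Bx * (z ^ 2 * (t ^ 2 * g₁)) := by
      have := hB h; gcongr
    have h4 : Fx * (z ^ 2 * (t ^ 2 * g₁)) ≤ (f + p₀ * D) * (z ^ 2 * (t ^ 2 * g₁)) := by gcongr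
    have h5 : t ^ 2 * g₁ * z * D * X ≤ α / (2 * d) * (g₁ * z ^ 2 * D ^ 2) +
        M ^ 2 / (2 * α * d) * (t ^ 2 * g₁ * X ^ 2) := by
      -- Young's inequality in exact form: the defect is a square plus a term that is nonnegative
      -- because `t d ≤ M`.
      have e : α / (2 * d) * (g₁ * z ^ 2 * D ^ 2) + M ^ 2 / (2 * α * d) * (t ^ 2 * g₁ * X ^ 2) -
          t ^ 2 * g₁ * z * D * X = g₁ / (2 * α * d) *
          ((α * z * D - M * t * X) ^ 2 + 2 * (α * z * D * X) * t * (M - t * d)) := by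
        field_simp; ring
      have : 0 ≤ g₁ / (2 * α * d) *
          ((α * z * D - M * t * X) ^ 2 + 2 * (α * z * D * X) * t * (M - t * d)) := by
        have := sub_nonneg.2 htM
        positivity
      linarith
    have h6 : z ^ 2 * (g₁ / d) * (α * D ^ 2) = 2 * (α / (2 * d) * (g₁ * z ^ 2 * D ^ 2)) := by
      field_simp
    have h7 : t ^ 2 * g₁ * z * D * X =
        p₀ * D * (z ^ 2 * (t ^ 2 * g₁)) - t ^ 2 * g₁ * (2 * z * -(β * D * Z)) := by
      rw [hX]; ring
    linarith

theorem gradient_sq {ζ : RN N → ℝ} (hζ : ContDiff ℝ ∞ ζ) (x : RN N) :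
    gradient (fun x => ζ x ^ 2) x = (2 * ζ x) • gradient ζ x := by
  have h : HasFDerivAt ζ (fderiv ℝ ζ x) x :=
    (hζ.differentiable (by simp)).differentiableAt.hasFDerivAt
  ext i
  simp only [PiLp.smul_apply, gradient_apply_eq_fderiv, smul_eq_mul]
  rw [(h.pow 2).fderiv]
  simp

theorem deriv_expNegInvGlue_rescaled (k d s : ℝ) :
    deriv (fun s => expNegInvGlue ((s - k) / d)) s = deriv expNegInvGlue ((s - k) / d) / d := by
  have h1 : HasDerivAt expNegInvGlue (deriv expNegInvGlue ((s - k) / d)) ((s - k) / d) :=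
    (expNegInvGlue.contDiff (n := ⊤)).differentiable (by simp) |>.differentiableAt.hasDerivAt
  have h2 : HasDerivAt (fun s => (s - k) / d) (1 / d) s :=
    ((hasDerivAt_id s).sub_const k).div_const d
  rw [show (fun s => expNegInvGlue ((s - k) / d)) = expNegInvGlue ∘ fun s => (s - k) / d from rfl,
    (h1.comp s h2).deriv]
  ring

/-- The structure conditions on the data of the equation at the point `x`, along `u`. -/
def StructureBounds (a : RN N → ℝ → RN N → RN N) (B : RN N → ℝ → ℝ) (F : RN N → RN N → ℝ)
    (u : RN N → ℝ) (Du : RN N → RN N) (α β p₀ m : ℝ) (F₀ : RN N → ℝ) (b : ℝ → ℝ) (x : RN N) :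
    Prop :=
  α * ‖Du x‖ ^ 2 ≤ inner ℝ (a x (u x) (Du x)) (Du x) ∧ ‖a x (u x) (Du x)‖ ≤ β * ‖Du x‖ ∧
    |F x (Du x)| ≤ F₀ x + p₀ * ‖Du x‖ ∧ 0 ≤ F₀ x ∧ ∀ s, 0 < s → m * b s ≤ B x s

section Energy

variable {Ω : Opens (RN N)} {a : RN N → ℝ → RN N → RN N} {B : RN N → ℝ → ℝ} {F : RN N → RN N → ℝ}
  {u : RN N → ℝ} {Du : RN N → RN N} {α β p₀ m : ℝ} {F₀ : RN N → ℝ} {b : ℝ → ℝ}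

theorem IsDistribSubsolution.energy_estimate (hsub : IsDistribSubsolution Ω a B F u Du)
    (hu : MemH1Loc Ω u Du) {K : Set (RN N)} (hK : IsCompact K) (hKΩ : K ⊆ (Ω : Set (RN N)))
    (hα : 0 < α) (hβ : 0 ≤ β) (hp₀ : 0 ≤ p₀) (hm : 0 ≤ m) (hb_mono : MonotoneOn b (Ici 0))
    (hF₀ : Integrable F₀ (volume.restrict K))
    (hstr : ∀ᵐ x ∂volume.restrict K, StructureBounds a B F u Du α β p₀ m F₀ b x)
    {M k d Z : ℝ} (huM : ∀ᵐ x ∂volume.restrict K, u x ≤ M) (hk : 0 ≤ k) (hd : 0 < d)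
    {ζ : RN N → ℝ} (hζ : ContDiff ℝ ∞ ζ) (hζ0 : ∀ x, 0 ≤ ζ x) (hζ1 : ∀ x, ζ x ≤ 1)
    (hζK : tsupport ζ ⊆ K) (hζZ : ∀ x, ‖gradient ζ x‖ ≤ Z) :
    α / (2 * d) * (∫ x in K, deriv expNegInvGlue ((u x - k) / d) * ζ x ^ 2 * ‖Du x‖ ^ 2) +
        m * b k * (∫ x in K, expNegInvGlue ((u x - k) / d) * ζ x ^ 2) ≤
      (∫ x in {x | k < u x}, F₀ x ∂volume.restrict K) +
        M ^ 2 / (2 * α * d) * (p₀ + 2 * β * Z) ^ 2 * (volume.restrict K).real {x | k < u x} := by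
  set μ := volume.restrict K with hμ
  have : IsFiniteMeasure μ := ⟨by simpa [hμ] using hK.measure_lt_top⟩
  set g : ℝ → ℝ := expNegInvGlue with hg
  have hgs : ContDiff ℝ ∞ g := expNegInvGlue.contDiff
  have hgc := hgs.continuous
  have hg'c : Continuous (deriv g) := hgs.continuous_deriv (by simp)
  have hum : AEStronglyMeasurable u μ := (hu.memLp K hK hKΩ).1
  have hDm : MemLp Du 2 μ := hu.memLp_grad K hK hKΩ
  have htm : AEStronglyMeasurable (fun x => (u x - k) / d) μ :=
    (show Continuous fun s : ℝ => (s - k) / d by fun_prop).comp_aestronglyMeasurable hum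
  have hgm : AEStronglyMeasurable (fun x => g ((u x - k) / d)) μ :=
    hgc.comp_aestronglyMeasurable htm
  have hg'm : AEStronglyMeasurable (fun x => deriv g ((u x - k) / d)) μ :=
    hg'c.comp_aestronglyMeasurable htm
  have hζm : AEStronglyMeasurable ζ μ := hζ.continuous.aestronglyMeasurable
  have hZ0 : 0 ≤ Z := (norm_nonneg _).trans (hζZ 0)
  have hζ2 : ∀ x, ζ x ^ 2 ≤ 1 := fun x => pow_le_one₀ (hζ0 x) (hζ1 x)
  have haL : MemLp (fun x => a x (u x) (Du x)) 2 μ := by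
    refine MemLp.of_le_mul (c := β) hDm (hsub.memLp_a K hK hKΩ).1 ?_
    filter_upwards [hstr] with x hx using hx.2.1
  have hai : Integrable (fun x => a x (u x) (Du x)) μ := haL.integrable (by norm_num)
  have hBi : Integrable (fun x => B x (u x)) μ :=
    memLp_one_iff_integrable.1 (hsub.memLp_B K hK hKΩ)
  have hFi : Integrable (fun x => F x (Du x)) μ :=
    memLp_one_iff_integrable.1 (hsub.memLp_F K hK hKΩ)
  have htest := hsub.integral_test_comp_le (L := 1 / d) (η := fun x => ζ x ^ 2)
    (G := fun s => g ((s - k) / d)) hu hK hKΩ haL (hζ.pow 2)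
    ((closure_mono fun x hx => by
      simp only [Function.mem_support] at hx ⊢; exact fun h => hx (by simp [h])).trans hζK)
    (fun x => sq_nonneg _) (hgs.comp ((contDiff_id.sub contDiff_const).div_const d))
    (fun s => expNegInvGlue.nonneg _) (fun s => expNegInvGlue.le_one _)
    (fun s => by
      rw [deriv_expNegInvGlue_rescaled, abs_div, abs_of_pos hd,
        abs_of_nonneg (expNegInvGlue.deriv_nonneg _)]
      gcongr
      exact expNegInvGlue.deriv_le_one _)
  have hdg : ∀ s, deriv (fun s => g ((s - k) / d)) s = deriv g ((s - k) / d) / d :=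
    deriv_expNegInvGlue_rescaled k d
  simp only [hdg, gradient_sq hζ, inner_smul_right] at htest
  set S : Set (RN N) := {x | k < u x} with hS
  have hSm : NullMeasurableSet S μ := nullMeasurableSet_lt aemeasurable_const hum.aemeasurable
  set c := M ^ 2 / (2 * α * d) * (p₀ + 2 * β * Z) ^ 2 with hc
  have hc0 : 0 ≤ c := by positivity
  have hbound : ∀ x, ‖ζ x ^ 2 * g ((u x - k) / d)‖ ≤ 1 := fun x => by
    rw [Real.norm_of_nonneg (mul_nonneg (sq_nonneg _) (expNegInvGlue.nonneg _))]
    exact mul_le_one₀ (hζ2 x) (expNegInvGlue.nonneg _) (expNegInvGlue.le_one _)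
  have hζgm : AEStronglyMeasurable (fun x => ζ x ^ 2 * g ((u x - k) / d)) μ := (hζm.pow 2).mul hgm
  have i1 : Integrable (fun x => ζ x ^ 2 * (deriv g ((u x - k) / d) / d) *
      inner ℝ (a x (u x) (Du x)) (Du x)) μ := by
    refine Integrable.bdd_mul (c := 1 / d) (integrable_inner_of_memLp_two haL hDm)
      ((hζm.pow 2).mul (by simpa only [div_eq_mul_inv] using hg'm.mul_const d⁻¹)) (Eventually.of_forall fun x => ?_)
    rw [Real.norm_of_nonneg (mul_nonneg (sq_nonneg _) (div_nonneg (expNegInvGlue.deriv_nonneg _)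
      hd.le)), ← one_mul (1 / d)]
    exact mul_le_mul (hζ2 x) (div_le_div_of_nonneg_right (expNegInvGlue.deriv_le_one _) hd.le)
      (div_nonneg (expNegInvGlue.deriv_nonneg _) hd.le) zero_le_one
  have i2 : Integrable (fun x => g ((u x - k) / d) *
      (2 * ζ x * inner ℝ (a x (u x) (Du x)) (gradient ζ x))) μ := by
    have hgζ := (continuous_gradient hζ).aestronglyMeasurable (μ := μ)
    have : Integrable (fun x => inner ℝ (a x (u x) (Du x)) (gradient ζ x)) μ := by
      refine (hai.norm.mul_const Z).mono' (hai.1.inner hgζ) (Eventually.of_forall fun x => ?_)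
      exact (norm_inner_le_norm _ _).trans
        (mul_le_mul_of_nonneg_left (hζZ x) (norm_nonneg _))
    refine Integrable.bdd_mul (c := 1) (Integrable.bdd_mul (c := 2) this (hζm.const_mul 2)
      (Eventually.of_forall fun x => ?_)) hgm (Eventually.of_forall fun x => ?_)
    · rw [Real.norm_of_nonneg (mul_nonneg zero_le_two (hζ0 x))]; linarith [hζ1 x]
    · rw [Real.norm_of_nonneg (expNegInvGlue.nonneg _)]; exact expNegInvGlue.le_one _
  have i3 : Integrable (fun x => B x (u x) * (ζ x ^ 2 * g ((u x - k) / d))) μ :=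
    hBi.mul_bdd (c := 1) hζgm (Eventually.of_forall hbound)
  have i4 : Integrable (fun x => F x (Du x) * (ζ x ^ 2 * g ((u x - k) / d))) μ :=
    hFi.mul_bdd (c := 1) hζgm (Eventually.of_forall hbound)
  have i5 : Integrable (S.indicator fun x => F₀ x + c) μ :=
    (hF₀.add (integrable_const c)).indicator₀ hSm
  have i6 : Integrable (fun x => deriv g ((u x - k) / d) * ζ x ^ 2 * ‖Du x‖ ^ 2) μ := by
    refine Integrable.bdd_mul (c := 1) (hDm.integrable_norm_pow (by norm_num))
      (hg'm.mul (hζm.pow 2)) (Eventually.of_forall fun x => ?_)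
    rw [Real.norm_of_nonneg (mul_nonneg (expNegInvGlue.deriv_nonneg _) (sq_nonneg _))]
    exact mul_le_one₀ (expNegInvGlue.deriv_le_one _) (sq_nonneg _) (hζ2 x)
  have i7 : Integrable (fun x => g ((u x - k) / d) * ζ x ^ 2) μ := by
    refine (integrable_const (1 : ℝ)).mono' (hgm.mul (hζm.pow 2)) (Eventually.of_forall fun x => ?_)
    rw [mul_comm]; exact hbound x
  have hpt : ∀ᵐ x ∂μ, α / (2 * d) * (deriv g ((u x - k) / d) * ζ x ^ 2 * ‖Du x‖ ^ 2) +
        m * b k * (g ((u x - k) / d) * ζ x ^ 2) ≤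
      ((ζ x ^ 2 * (deriv g ((u x - k) / d) / d) * inner ℝ (a x (u x) (Du x)) (Du x) +
        g ((u x - k) / d) * (2 * ζ x * inner ℝ (a x (u x) (Du x)) (gradient ζ x))) +
        B x (u x) * (ζ x ^ 2 * g ((u x - k) / d)) - F x (Du x) * (ζ x ^ 2 * g ((u x - k) / d))) +
        S.indicator (fun x => F₀ x + c) x := by
    -- On `{u > k}`, monotonicity of `b` gives `B(x, u) ≥ m b(u) ≥ m b(k)`; off this set `g` and
    -- `g'` vanish and nothing has to be proved.
    filter_upwards [hstr, huM] with x hx hxM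
    obtain ⟨h1, h2, h3, h4, h5⟩ := hx
    have hI₂ : -(β * ‖Du x‖ * ‖gradient ζ x‖) ≤ inner ℝ (a x (u x) (Du x)) (gradient ζ x) := by
      have := neg_le_of_abs_le (abs_real_inner_le_norm (a x (u x) (Du x)) (gradient ζ x))
      have h6 := mul_le_mul_of_nonneg_right h2 (norm_nonneg (gradient ζ x))
      linarith
    have hBk : k < u x → m * b k ≤ B x (u x) := fun h =>
      (mul_le_mul_of_nonneg_left (hb_mono hk (hk.trans h.le) h.le) hm).trans
        (h5 _ (hk.trans_lt h))
    have hcp := caccioppoli_pointwise (bk := b k) hα hβ hp₀ hk hd hxM (norm_nonneg (Du x)) (hζ0 x)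
      (norm_nonneg (gradient ζ x)) h1 hI₂ hBk ((le_abs_self _).trans h3)
    have hrest : F₀ x * (ζ x ^ 2 * g ((u x - k) / d)) + M ^ 2 / (2 * α * d) *
        (g ((u x - k) / d) * (p₀ * ζ x + 2 * β * ‖gradient ζ x‖) ^ 2) ≤
        S.indicator (fun x => F₀ x + c) x := by
      by_cases hxS : x ∈ S
      · rw [indicator_of_mem hxS]
        refine add_le_add ?_ ?_
        · exact mul_le_of_le_one_right h4 ((le_abs_self _).trans (hbound x))
        · rw [hc]
          refine mul_le_mul_of_nonneg_left ?_ (by positivity)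
          rw [← one_mul ((p₀ + 2 * β * Z) ^ 2)]
          refine mul_le_mul (expNegInvGlue.le_one _) ?_ (sq_nonneg _) zero_le_one
          have := hζ0 x
          have := mul_le_of_le_one_right hp₀ (hζ1 x)
          have := hζZ x
          gcongr
      · have hle : (u x - k) / d ≤ 0 :=
          div_nonpos_of_nonpos_of_nonneg (by simp only [hS, mem_ofPred_eq, not_lt] at hxS; linarith)
            hd.le
        rw [indicator_of_notMem hxS, hg, expNegInvGlue.zero_of_nonpos hle]
        simp
    linarith
  have hint := integral_mono_ae ((i6.const_mul (α / (2 * d))).add (i7.const_mul (m * b k)))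
    ((((i1.add i2).add i3).sub i4).add i5) hpt
  have e1 := integral_add (i6.const_mul (α / (2 * d))) (i7.const_mul (m * b k))
  have e2 := integral_add (((i1.add i2).add i3).sub i4) i5
  have e3 := integral_sub ((i1.add i2).add i3) i4
  have e4 := integral_add (i1.add i2) i3
  have e5 : ∫ x, S.indicator (fun x => F₀ x + c) x ∂μ = (∫ x in S, F₀ x ∂μ) + c * μ.real S := by
    rw [integral_indicator₀ hSm, integral_add hF₀.integrableOn (integrable_const c)]
    simp [mul_comm]
  simp only [integral_const_mul] at e1
  simp only [Pi.add_apply, Pi.sub_apply] at hint e1 e2 e3 e4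
  linarith

end Energy

/-! ### Estimates for the measures of superlevel sets. -/

/-- Chebyshev's inequality combined with the `L¹` Sobolev inequality; `1 - 1/N` is the reciprocal of
the conjugate exponent of `N`. -/
theorem exists_sobolev_level_const (hN : 2 ≤ N) : ∃ C : ℝ, 0 < C ∧
    ∀ {Ω : Opens (RN N)} {u : RN N → ℝ} {Du : RN N → RN N} {K : Set (RN N)} {η : RN N → ℝ}
      {G : ℝ → ℝ} {L ε : ℝ}, MemH1Loc Ω u Du → IsCompact K → K ⊆ (Ω : Set (RN N)) →
      ContDiff ℝ ∞ η → tsupport η ⊆ K → ContDiff ℝ ∞ G → (∀ s, 0 ≤ G s) → (∀ s, G s ≤ 1) →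
      (∀ s, |deriv G s| ≤ L) → 0 ≤ ε →
      ε * (volume.restrict K).real {x | ε ≤ η x * G (u x)} ^ (1 - 1 / (N : ℝ)) ≤
        C * ∫ x in K, ‖(η x * deriv G (u x)) • Du x + G (u x) • gradient η x‖ := by
  set p := (N : ℝ).conjExponent with hp
  have hN1 : (1 : ℝ) < N := by exact_mod_cast hN
  have hpN : Real.HolderConjugate (N : ℝ) p := Real.HolderConjugate.conjExponent hN1
  have hp0 : 0 < p := hpN.symm.pos
  have hpinv : 1 - 1 / (N : ℝ) = 1 / p := by
    have := hpN.inv_add_inv_eq_one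
    rw [one_div, one_div]; linarith
  set c₀ : ℝ := (lintegralPowLePowLIntegralFDerivConst (volume : Measure (RN N)) p : ℝ) with hc₀
  have hc₀0 : 0 ≤ c₀ := NNReal.coe_nonneg _
  refine ⟨(c₀ + 1) ^ (1 / p), by positivity, ?_⟩
  intro Ω u Du K η G L ε hu hK hKΩ hη hηK hG hG0 hG1 hGL hε
  have : IsFiniteMeasure (volume.restrict K) := ⟨by simpa using hK.measure_lt_top⟩
  have h := hu.lintegral_pow_comp_le hN hK hKΩ hη hηK hG hG0 hG1 hGL
  rw [← hp] at h
  set I := ∫ x in K, ‖(η x * deriv G (u x)) • Du x + G (u x) • gradient η x‖ with hI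
  have hI0 : 0 ≤ I := integral_nonneg fun x => norm_nonneg _
  set S := {x | ε ≤ η x * G (u x)} with hS
  have hm : AEMeasurable (fun x => ‖η x * G (u x)‖ₑ ^ p) (volume.restrict K) :=
    ((hη.continuous.aestronglyMeasurable.mul (hG.continuous.comp_aestronglyMeasurable
      (hu.memLp K hK hKΩ).1)).enorm).pow_const p
  have h1 : ENNReal.ofReal ε ^ p * (volume.restrict K) S ≤
      ENNReal.ofReal c₀ * ENNReal.ofReal I ^ p := by
    have h2 := mul_meas_ge_le_lintegral₀ hm (ENNReal.ofReal ε ^ p)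
    have h3 : (volume.restrict K) S ≤
        (volume.restrict K) {x | ENNReal.ofReal ε ^ p ≤ ‖η x * G (u x)‖ₑ ^ p} := by
      refine measure_mono fun x hx => ?_
      refine ENNReal.rpow_le_rpow ?_ hp0.le
      rw [← ofReal_norm]
      exact ENNReal.ofReal_le_ofReal (le_trans hx (le_abs_self _))
    have h4 : ENNReal.ofReal c₀ =
        (lintegralPowLePowLIntegralFDerivConst (volume : Measure (RN N)) p : ℝ≥0∞) := by
      rw [hc₀, ENNReal.ofReal_coe_nnreal]
    rw [h4]
    exact (mul_le_mul_right h3 _).trans (h2.trans h)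
  have h2 : ε ^ p * (volume.restrict K).real S ≤ c₀ * I ^ p := by
    have h3 := ENNReal.toReal_mono (by
      exact ENNReal.mul_ne_top ENNReal.ofReal_ne_top (ENNReal.rpow_ne_top_of_nonneg hp0.le
        ENNReal.ofReal_ne_top)) h1
    rw [ENNReal.toReal_mul, ENNReal.toReal_mul, ← ENNReal.toReal_rpow, ← ENNReal.toReal_rpow,
      ENNReal.toReal_ofReal hε, ENNReal.toReal_ofReal hI0, ENNReal.toReal_ofReal hc₀0] at h3
    exact h3
  have h3 : ε ^ p * (volume.restrict K).real S ≤ (c₀ + 1) * I ^ p :=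
    h2.trans (mul_le_mul_of_nonneg_right (by linarith) (by positivity))
  have h4 := Real.rpow_le_rpow (by positivity) h3 (show 0 ≤ 1 / p by positivity)
  rw [Real.mul_rpow (by positivity) measureReal_nonneg, Real.mul_rpow (by positivity)
    (by positivity), ← Real.rpow_mul hε, ← Real.rpow_mul hI0, mul_one_div_cancel hp0.ne',
    Real.rpow_one, Real.rpow_one] at h4
  rwa [hpinv]

/-- The measure of the set `{u > k}` in the closed ball of radius `r` around `x₀`. -/
noncomputable def superlevelVolume (u : RN N → ℝ) (x₀ : RN N) (k r : ℝ) : ℝ :=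
  (volume.restrict (Metric.closedBall x₀ r)).real {x | k < u x}

theorem superlevelVolume_nonneg (u : RN N → ℝ) (x₀ : RN N) (k r : ℝ) :
    0 ≤ superlevelVolume u x₀ k r := measureReal_nonneg

/-- The same energy estimate is read twice. Keeping the absorption term gives the first bound, which
provides smallness when `b k` is large; keeping the gradient term and applying Sobolev gives the
second, which is the De Giorgi recursion. -/
theorem exists_level_set_const (hN : 2 ≤ N) : ∃ C : ℝ, 0 < C ∧
    ∀ {Ω : Opens (RN N)} {a : RN N → ℝ → RN N → RN N} {B : RN N → ℝ → ℝ} {F : RN N → RN N → ℝ}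
      {u : RN N → ℝ} {Du : RN N → RN N} {α β p₀ m Λ θ : ℝ} {F₀ : RN N → ℝ} {b : ℝ → ℝ}
      {x₀ : RN N} {M k d r' r : ℝ},
      IsDistribSubsolution Ω a B F u Du → MemH1Loc Ω u Du → 0 < α → 0 ≤ β → 0 ≤ p₀ → 0 ≤ m →
      MonotoneOn b (Ici 0) → (∀ s, 0 ≤ s → 0 ≤ b s) →
      0 < r' → r' < r → Metric.closedBall x₀ r ⊆ (Ω : Set (RN N)) →
      Integrable F₀ (volume.restrict (Metric.closedBall x₀ r)) →
      (∀ᵐ x ∂volume.restrict (Metric.closedBall x₀ r), StructureBounds a B F u Du α β p₀ m F₀ b x) →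
      (∀ᵐ x ∂volume.restrict (Metric.closedBall x₀ r), u x ≤ M) → 0 ≤ k → 0 < d →
      (∫ x in {x | k < u x}, F₀ x ∂volume.restrict (Metric.closedBall x₀ r)) ≤
        Λ * superlevelVolume u x₀ k r ^ θ →
      m * b k * (Real.exp (-3) * superlevelVolume u x₀ (k + d) r') ≤
        Λ * superlevelVolume u x₀ k r ^ θ +
          M ^ 2 / (2 * α * d) * (p₀ + 4 * β / (r - r')) ^ 2 * superlevelVolume u x₀ k r ∧
      superlevelVolume u x₀ (k + d) r' ^ (1 - 1 / (N : ℝ)) ≤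
        C * (1 / d * √(2 * d / α * (Λ * superlevelVolume u x₀ k r ^ θ +
          M ^ 2 / (2 * α * d) * (p₀ + 4 * β / (r - r')) ^ 2 * superlevelVolume u x₀ k r) *
            superlevelVolume u x₀ k r) + 4 / (r - r') * superlevelVolume u x₀ k r) := by
  obtain ⟨C₀, hC₀, hsob⟩ := exists_sobolev_level_const hN
  have hN1 : (1 : ℝ) < N := by exact_mod_cast hN
  refine ⟨Real.exp 3 * C₀, by positivity, ?_⟩
  intro Ω a B F u Du α β p₀ m Λ θ F₀ b x₀ M k d r' r hsub hu hα hβ hp₀ hm hb_mono hb hr' hr hKΩ hF₀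
    hstr huM hk hd hΛ
  obtain ⟨ζ, hζ, hζ0, hζ1, hζK, hζZ, hζr⟩ := exists_smooth_cutoff x₀ hr' hr
  set K := Metric.closedBall x₀ r with hKdef
  have hK : IsCompact K := isCompact_closedBall x₀ r
  set μ := volume.restrict K with hμ
  have : IsFiniteMeasure μ := ⟨by simpa [hμ] using hK.measure_lt_top⟩
  have hE := hsub.energy_estimate hu hK hKΩ hα hβ hp₀ hm hb_mono hF₀ hstr huM hk hd hζ hζ0 hζ1 hζK
    hζZ
  set A := superlevelVolume u x₀ k r with hA
  have hA0 : 0 ≤ A := superlevelVolume_nonneg _ _ _ _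
  have hA' : μ.real {x | k < u x} = A := rfl
  rw [hA', show 2 * β * (2 / (r - r')) = 4 * β / (r - r') by ring] at hE
  set R := Λ * A ^ θ + M ^ 2 / (2 * α * d) * (p₀ + 4 * β / (r - r')) ^ 2 * A with hR
  set g : ℝ → ℝ := expNegInvGlue with hg
  have hδ : 0 < r - r' := sub_pos.2 hr
  have hgs : ContDiff ℝ ∞ g := expNegInvGlue.contDiff
  have hg'c : Continuous (deriv g) := hgs.continuous_deriv (by simp)
  have hum : AEStronglyMeasurable u μ := (hu.memLp K hK hKΩ).1
  have hDm : MemLp Du 2 μ := hu.memLp_grad K hK hKΩ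
  have htm : AEStronglyMeasurable (fun x => (u x - k) / d) μ :=
    (show Continuous fun s : ℝ => (s - k) / d by fun_prop).comp_aestronglyMeasurable hum
  have hgm : AEStronglyMeasurable (fun x => g ((u x - k) / d)) μ :=
    hgs.continuous.comp_aestronglyMeasurable htm
  have hg'm : AEStronglyMeasurable (fun x => deriv g ((u x - k) / d)) μ :=
    hg'c.comp_aestronglyMeasurable htm
  have hζm : AEStronglyMeasurable ζ μ := hζ.continuous.aestronglyMeasurable
  have hζ2 : ∀ x, ζ x ^ 2 ≤ 1 := fun x => pow_le_one₀ (hζ0 x) (hζ1 x)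
  have hbk : 0 ≤ m * b k := mul_nonneg hm (hb k hk)
  set E := ∫ x in K, deriv g ((u x - k) / d) * ζ x ^ 2 * ‖Du x‖ ^ 2 with hEdef
  set W := ∫ x in K, g ((u x - k) / d) * ζ x ^ 2 with hW
  have hE0 : 0 ≤ E := integral_nonneg fun x =>
    mul_nonneg (mul_nonneg (expNegInvGlue.deriv_nonneg _) (sq_nonneg _)) (sq_nonneg _)
  have hW0 : 0 ≤ W := integral_nonneg fun x =>
    mul_nonneg (expNegInvGlue.nonneg _) (sq_nonneg _)
  have hER : α / (2 * d) * E + m * b k * W ≤ R := by rw [hR]; linarith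
  set S : Set (RN N) := {x | k < u x} with hS
  have hSm : NullMeasurableSet S μ := nullMeasurableSet_lt aemeasurable_const hum.aemeasurable
  have hoff : ∀ x, x ∉ S → g ((u x - k) / d) = 0 ∧ deriv g ((u x - k) / d) = 0 := fun x hx => by
    have hle : (u x - k) / d ≤ 0 :=
      div_nonpos_of_nonpos_of_nonneg (by simp only [hS, mem_ofPred_eq, not_lt] at hx; linarith) hd.le
    rw [hg, expNegInvGlue.deriv_eq, expNegInvGlue.zero_of_nonpos hle]
    simp
  have hlevel : superlevelVolume u x₀ (k + d) r' ≤
      μ.real {x | Real.exp (-3) ≤ ζ x ^ 2 * g ((u x - k) / d)} := by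
    refine ENNReal.toReal_mono (measure_ne_top _ _) ?_
    rw [Measure.restrict_apply' Metric.isClosed_closedBall.measurableSet, hμ,
      Measure.restrict_apply' hK.measurableSet]
    refine measure_mono fun x hx => ⟨?_, Metric.closedBall_subset_closedBall hr.le hx.2⟩
    have h1 := hζr x hx.2
    have h2 : Real.exp (-1) ≤ g ((u x - k) / d) := by
      refine expNegInvGlue.exp_neg_one_le ?_
      rw [one_le_div hd]
      have : k + d < u x := hx.1
      linarith
    -- Two factors `e⁻¹` come from `ζ²` on the inner ball, and one from `g` at arguments at least
    -- `1`, where `u > k + d`.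
    have h3 : Real.exp (-3) = Real.exp (-1) ^ 2 * Real.exp (-1) := by
      rw [← Real.exp_nat_mul, ← Real.exp_add]; norm_num
    show Real.exp (-3) ≤ ζ x ^ 2 * g ((u x - k) / d)
    rw [h3]
    gcongr
  constructor
  · have h1 : Real.exp (-3) * superlevelVolume u x₀ (k + d) r' ≤ W := by
      refine (mul_le_mul_of_nonneg_left hlevel (Real.exp_pos _).le).trans ?_
      have i7 : Integrable (fun x => ζ x ^ 2 * g ((u x - k) / d)) μ := by
        refine (integrable_const (1 : ℝ)).mono' ((hζm.pow 2).mul hgm)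
          (Eventually.of_forall fun x => ?_)
        rw [Real.norm_of_nonneg (mul_nonneg (sq_nonneg _) (expNegInvGlue.nonneg _))]
        exact mul_le_one₀ (hζ2 x) (expNegInvGlue.nonneg _) (expNegInvGlue.le_one _)
      have := mul_meas_ge_le_integral_of_nonneg (Eventually.of_forall fun x =>
        mul_nonneg (sq_nonneg (ζ x)) (expNegInvGlue.nonneg ((u x - k) / d))) i7 (Real.exp (-3))
      refine this.trans_eq ?_
      simp only [hW, mul_comm]
      rfl
    have h2 : 0 ≤ α / (2 * d) * E := by positivity
    have h3 := mul_le_mul_of_nonneg_left h1 hbk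
    linarith
  · have hE1 : E ≤ 2 * d / α * R := by
      have : α / (2 * d) * E ≤ R := by linarith [mul_nonneg hbk hW0]
      rw [← div_le_iff₀' (by positivity)]
      refine le_trans (le_of_eq ?_) this
      field_simp
    have hdg : ∀ s, deriv (fun s => g ((s - k) / d)) s = deriv g ((s - k) / d) / d :=
      deriv_expNegInvGlue_rescaled k d
    have hs := hsob (L := 1 / d) (η := fun x => ζ x ^ 2) (G := fun s => g ((s - k) / d))
      (ε := Real.exp (-3)) hu hK hKΩ (hζ.pow 2)
      ((closure_mono fun x hx => by
        simp only [Function.mem_support] at hx ⊢; exact fun h => hx (by simp [h])).trans hζK)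
      (hgs.comp ((contDiff_id.sub contDiff_const).div_const d))
      (fun s => expNegInvGlue.nonneg _) (fun s => expNegInvGlue.le_one _)
      (fun s => by
        rw [deriv_expNegInvGlue_rescaled, abs_div, abs_of_pos hd,
          abs_of_nonneg (expNegInvGlue.deriv_nonneg _)]
        gcongr
        exact expNegInvGlue.deriv_le_one _) (Real.exp_pos _).le
    simp only [hdg, gradient_sq hζ] at hs
    -- Splitting `ζ² g' |Du|` as `(φ |Du|) · φ`, Cauchy-Schwarz bounds its integral by the root of
    -- the energy `E` times the measure `A`, as `φ² ≤ 1` vanishes off `{u > k}`.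
    set φ : RN N → ℝ := fun x => ζ x * √(deriv g ((u x - k) / d)) with hφ
    have hφm : AEStronglyMeasurable φ μ :=
      hζm.mul (Real.continuous_sqrt.comp_aestronglyMeasurable hg'm)
    have hφ1 : ∀ x, ‖φ x‖ ≤ 1 := fun x => by
      rw [hφ, Real.norm_of_nonneg (mul_nonneg (hζ0 x) (Real.sqrt_nonneg _))]
      exact mul_le_one₀ (hζ1 x) (Real.sqrt_nonneg _)
        (Real.sqrt_le_one.2 (expNegInvGlue.deriv_le_one _))
    have hφ2 : ∀ x, φ x ^ 2 = deriv g ((u x - k) / d) * ζ x ^ 2 := fun x => by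
      rw [hφ, mul_pow, Real.sq_sqrt (expNegInvGlue.deriv_nonneg _), mul_comm]
    have hφL : MemLp φ 2 μ := MemLp.of_bound hφm 1 (Eventually.of_forall hφ1)
    have hφD : MemLp (fun x => φ x * ‖Du x‖) 2 μ := by
      refine MemLp.of_le_mul (c := 1) hDm (hφm.mul hDm.1.norm) (Eventually.of_forall fun x => ?_)
      rw [norm_mul, norm_norm]
      exact mul_le_mul_of_nonneg_right (hφ1 x) (norm_nonneg _)
    have hφDi : Integrable (fun x => φ x * ‖Du x‖ * φ x) μ := hφD.integrable_mul hφL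
    have hcs : ∫ x, φ x * ‖Du x‖ * φ x ∂μ ≤ √(E * A) := by
      have h1 := integral_mul_norm_le_Lp_mul_Lq (μ := μ) (f := fun x => φ x * ‖Du x‖) (g := φ)
        (p := 2) (q := 2) Real.HolderConjugate.two_two (by simpa using hφD) (by simpa using hφL)
      have h2 : ∫ x, ‖φ x * ‖Du x‖‖ ^ (2 : ℝ) ∂μ = E := by
        refine integral_congr_ae (Eventually.of_forall fun x => ?_)
        simp only [Real.rpow_two, Real.norm_eq_abs, sq_abs]
        rw [mul_pow, hφ2]
      have h3 : ∫ x, ‖φ x‖ ^ (2 : ℝ) ∂μ ≤ A := by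
        have h4 : ∫ x, S.indicator (fun _ => (1 : ℝ)) x ∂μ = A := by
          rw [integral_indicator₀ hSm]; simp [hA']
        rw [← h4]
        refine integral_mono (by simpa using hφL.integrable_norm_pow (p := 2) (by norm_num))
          ((integrable_const (1 : ℝ)).indicator₀ hSm) fun x => ?_
        simp only [Real.rpow_two, Real.norm_eq_abs, sq_abs]
        by_cases hx : x ∈ S
        · rw [indicator_of_mem hx, hφ2]
          exact mul_le_one₀ (expNegInvGlue.deriv_le_one _) (sq_nonneg _) (hζ2 x)
        · rw [indicator_of_notMem hx, hφ2, (hoff x hx).2, zero_mul]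
      rw [h2] at h1
      rw [Real.sqrt_mul hE0]
      refine le_trans (integral_mono hφDi ((hφD.norm).integrable_mul hφL.norm) fun x => ?_)
        (h1.trans ?_)
      · exact (le_abs_self _).trans_eq (abs_mul _ _)
      · rw [← Real.sqrt_eq_rpow, ← Real.sqrt_eq_rpow]
        exact mul_le_mul_of_nonneg_left (Real.sqrt_le_sqrt h3) (Real.sqrt_nonneg _)
    have hI : ∫ x in K, ‖(ζ x ^ 2 * (deriv g ((u x - k) / d) / d)) • Du x +
        g ((u x - k) / d) • (2 * ζ x) • gradient ζ x‖ ≤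
        1 / d * √(2 * d / α * R * A) + 4 / (r - r') * A := by
      have h1 : ∫ x in K, ‖(ζ x ^ 2 * (deriv g ((u x - k) / d) / d)) • Du x +
          g ((u x - k) / d) • (2 * ζ x) • gradient ζ x‖ ≤
          ∫ x, (1 / d * (φ x * ‖Du x‖ * φ x) + S.indicator (fun _ => 4 / (r - r')) x) ∂μ := by
        refine integral_mono_of_nonneg (Eventually.of_forall fun x => norm_nonneg _)
          ((hφDi.const_mul _).add ((integrable_const _).indicator₀ hSm))
          (Eventually.of_forall fun x => ?_)
        refine (norm_add_le _ _).trans (add_le_add (le_of_eq ?_) ?_)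
        · rw [norm_smul, Real.norm_of_nonneg (mul_nonneg (sq_nonneg _)
            (div_nonneg (expNegInvGlue.deriv_nonneg _) hd.le))]
          rw [show φ x * ‖Du x‖ * φ x = φ x ^ 2 * ‖Du x‖ by ring, hφ2]
          ring
        · by_cases hx : x ∈ S
          · rw [indicator_of_mem hx, norm_smul, norm_smul, Real.norm_of_nonneg
              (expNegInvGlue.nonneg _), Real.norm_of_nonneg (mul_nonneg zero_le_two (hζ0 x)),
              show 4 / (r - r') = 1 * (2 * 1 * (2 / (r - r'))) by ring]
            have := hζZ x
            have := hζ1 x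
            have := hζ0 x
            have := expNegInvGlue.le_one ((u x - k) / d)
            gcongr
          · rw [indicator_of_notMem hx, (hoff x hx).1, zero_smul, norm_zero]
      have h2 : ∫ x, (1 / d * (φ x * ‖Du x‖ * φ x) + S.indicator (fun _ => 4 / (r - r')) x) ∂μ =
          1 / d * (∫ x, φ x * ‖Du x‖ * φ x ∂μ) + 4 / (r - r') * A := by
        rw [integral_add (hφDi.const_mul _) ((integrable_const _).indicator₀ hSm),
          integral_const_mul, integral_indicator₀ hSm]
        simp [hA', mul_comm]
      rw [h2] at h1
      refine h1.trans (add_le_add_left (mul_le_mul_of_nonneg_left (hcs.trans ?_) (by positivity)) _)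
      exact Real.sqrt_le_sqrt (mul_le_mul_of_nonneg_right hE1 hA0)
    have hexp : Real.exp 3 * Real.exp (-3) = 1 := by rw [← Real.exp_add]; norm_num
    have hexpo : 0 ≤ 1 - 1 / (N : ℝ) := by
      rw [sub_nonneg, div_le_one (by linarith)]; exact hN1.le
    calc superlevelVolume u x₀ (k + d) r' ^ (1 - 1 / (N : ℝ))
        ≤ μ.real {x | Real.exp (-3) ≤ ζ x ^ 2 * g ((u x - k) / d)} ^ (1 - 1 / (N : ℝ)) :=
          Real.rpow_le_rpow (superlevelVolume_nonneg _ _ _ _) hlevel hexpo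
      _ = Real.exp 3 * (Real.exp (-3) *
          μ.real {x | Real.exp (-3) ≤ ζ x ^ 2 * g ((u x - k) / d)} ^ (1 - 1 / (N : ℝ))) := by
          rw [← mul_assoc, hexp, one_mul]
      _ ≤ Real.exp 3 * (C₀ * (1 / d * √(2 * d / α * R * A) + 4 / (r - r') * A)) := by
          refine mul_le_mul_of_nonneg_left (hs.trans ?_) (Real.exp_pos _).le
          exact mul_le_mul_of_nonneg_left hI hC₀.le
      _ = _ := (mul_assoc _ _ _).symm

/-! ### De Giorgi iteration and the halving principle. -/

/-- The bound `y j ≤ ε l^j` propagates: `l^(s-p) = 1/4` cancels the growth `4^j`, and `ε` is small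
enough that `C ε^(s-p) ≤ l^p`. Taking `ε ≤ 1` keeps `y j ≤ 1`, so that the recursion stays
available. -/
theorem exists_fast_geometric_const {p s C : ℝ} (hp : 0 < p) (hps : p < s) (hC : 0 < C) :
    ∃ ε : ℝ, 0 < ε ∧ ∀ y : ℕ → ℝ, (∀ j, 0 ≤ y j) → y 0 ≤ ε →
      (∀ j, y j ≤ 1 → y (j + 1) ^ p ≤ C * 4 ^ j * y j ^ s) → Tendsto y atTop (𝓝 0) := by
  have hsp : 0 < s - p := sub_pos.2 hps
  set l : ℝ := (1 / 4 : ℝ) ^ (1 / (s - p)) with hl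
  have hl0 : 0 < l := by positivity
  have hl1 : l < 1 := Real.rpow_lt_one (by norm_num) (by norm_num) (by positivity)
  have hlsp : l ^ (s - p) = 1 / 4 := by
    rw [hl, ← Real.rpow_mul (by norm_num), one_div_mul_cancel hsp.ne', Real.rpow_one]
  set ε₀ : ℝ := (l ^ p / C) ^ (1 / (s - p)) with hε₀
  have hε₀0 : 0 < ε₀ := by positivity
  have hε₀sp : ε₀ ^ (s - p) = l ^ p / C := by
    rw [hε₀, ← Real.rpow_mul (by positivity), one_div_mul_cancel hsp.ne', Real.rpow_one]
  refine ⟨min 1 ε₀, by positivity, fun y hy0 hy hrec => ?_⟩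
  set ε := min 1 ε₀ with hε
  have hε0 : 0 < ε := by positivity
  have hCε : C * ε ^ (s - p) ≤ l ^ p := by
    have : ε ^ (s - p) ≤ l ^ p / C := by
      rw [← hε₀sp]
      exact Real.rpow_le_rpow hε0.le (min_le_right _ _) hsp.le
    rwa [le_div_iff₀' hC] at this
  have key : ∀ j, y j ≤ ε * l ^ j := by
    intro j
    induction j with
    | zero => simpa using hy
    | succ j ih =>
      have hlj : 0 < l ^ j := by positivity
      have hj1 : y j ≤ 1 := ih.trans
        (mul_le_one₀ (min_le_left _ _) hlj.le (pow_le_one₀ hl0.le hl1.le))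
      rw [← Real.rpow_le_rpow_iff (hy0 _) (by positivity) hp]
      have h4 : (4 : ℝ) ^ j * (l ^ j) ^ (s - p) = 1 := by
        rw [← Real.rpow_natCast l, ← Real.rpow_mul hl0.le, mul_comm (j : ℝ), Real.rpow_mul hl0.le,
          hlsp, Real.rpow_natCast, ← mul_pow]
        norm_num
      have hs : ∀ z : ℝ, 0 < z → z ^ s = z ^ (s - p) * z ^ p := fun z hz => by
        rw [← Real.rpow_add hz]; ring_nf
      calc y (j + 1) ^ p ≤ C * 4 ^ j * y j ^ s := hrec j hj1
        _ ≤ C * 4 ^ j * (ε * l ^ j) ^ s := by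
          have := Real.rpow_le_rpow (hy0 j) ih (hp.trans hps).le
          gcongr
        _ = (C * ε ^ (s - p)) * (4 ^ j * (l ^ j) ^ (s - p)) * (ε ^ p * (l ^ j) ^ p) := by
          rw [hs _ (by positivity), Real.mul_rpow hε0.le hlj.le, Real.mul_rpow hε0.le hlj.le]
          ring
        _ ≤ l ^ p * 1 * (ε ^ p * (l ^ j) ^ p) := by
          rw [h4]; gcongr
        _ = (ε * l ^ (j + 1)) ^ p := by
          rw [pow_succ, Real.mul_rpow hε0.le (by positivity), Real.mul_rpow hlj.le hl0.le]
          ring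
  refine squeeze_zero hy0 key ?_
  simpa using (tendsto_pow_atTop_nhds_zero_of_lt_one hl0.le hl1).const_mul ε

/-- At step `j` of the iteration `τ = 2^j`, with level increment `M/(8τ)` and radius decrement
`ρ/(4τ)`. The height `M` disappears: it cancels against the increment in the gradient term, and `M ≥
1` disposes of it in the term from `F₀`. -/
theorem degiorgi_step_bound {α β p₀ Λ θ M ρ τ A : ℝ} (hα : 0 < α) (hβ : 0 ≤ β) (hp₀ : 0 ≤ p₀)
    (hΛ : 0 ≤ Λ) (hM : 1 ≤ M) (hρ : 0 < ρ) (hρ1 : ρ ≤ 1) (hτ : 1 ≤ τ) (hA : 0 ≤ A)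
    (hθ : 0 ≤ θ) :
    1 / (M / (8 * τ)) * √(2 * (M / (8 * τ)) / α * (Λ * A ^ θ +
        M ^ 2 / (2 * α * (M / (8 * τ))) * (p₀ + 4 * β / (ρ / (4 * τ))) ^ 2 * A) * A) +
        4 / (ρ / (4 * τ)) * A ≤
      τ ^ 2 * (√(16 * Λ / α) * A ^ ((θ + 1) / 2) + (8 / α * (p₀ + 16 * β) + 16) * (A / ρ)) := by
  have hτ0 : 0 < τ := by linarith
  have hM0 : 0 < M := by linarith
  have hττ : τ ≤ τ ^ 2 := by nlinarith
  set X := p₀ + 4 * β / (ρ / (4 * τ)) with hX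
  have hX0 : 0 ≤ X := by positivity
  have hXle : X ≤ τ * (p₀ + 16 * β) / ρ := by
    have e : X = (p₀ * ρ + 16 * β * τ) / ρ := by rw [hX]; field_simp; ring
    rw [e]
    have : p₀ * ρ ≤ τ * p₀ := by nlinarith
    gcongr
    linarith
  have hAs : A ^ θ * A = (A ^ ((θ + 1) / 2)) ^ 2 := by
    rw [← Real.rpow_natCast, ← Real.rpow_mul hA]
    rcases hA.eq_or_lt with h | h
    · rw [← h, mul_zero, Real.zero_rpow]; positivity
    · conv_lhs => rw [← Real.rpow_one A, ← Real.rpow_mul hA, ← Real.rpow_add h]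
      congr 1
      push_cast; ring
  set Y := A ^ ((θ + 1) / 2) with hY
  have hY0 : 0 ≤ Y := by positivity
  set d := M / (8 * τ) with hd
  have hd0 : 0 < d := by positivity
  have h1 : 2 * d / α * (Λ * A ^ θ + M ^ 2 / (2 * α * d) * X ^ 2 * A) * A =
      2 * d / α * Λ * Y ^ 2 + (M / α * X * A) ^ 2 := by
    rw [← hAs]; field_simp
  have h2 : √(2 * d / α * (Λ * A ^ θ + M ^ 2 / (2 * α * d) * X ^ 2 * A) * A) ≤
      √(2 * d / α * Λ) * Y + M / α * X * A := by
    rw [h1]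
    refine Real.sqrt_le_iff.2 ⟨by positivity, ?_⟩
    have e : (√(2 * d / α * Λ) * Y + M / α * X * A) ^ 2 = √(2 * d / α * Λ) ^ 2 * Y ^ 2 +
        (M / α * X * A) ^ 2 + 2 * (√(2 * d / α * Λ) * Y) * (M / α * X * A) := by ring
    rw [e, Real.sq_sqrt (by positivity)]
    exact le_add_of_nonneg_right (by positivity)
  have h3 : 1 / d * √(2 * d / α * Λ) ≤ τ ^ 2 * √(16 * Λ / α) := by
    have e : 1 / d * √(2 * d / α * Λ) = √(2 * Λ / (α * d)) := by
      rw [← Real.sqrt_sq (show 0 ≤ 1 / d by positivity), ← Real.sqrt_mul (by positivity)]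
      congr 1
      field_simp
    have e' : τ ^ 2 * √(16 * Λ / α) = √(τ ^ 4 * (16 * Λ / α)) := by
      rw [Real.sqrt_mul (by positivity), show τ ^ 4 = (τ ^ 2) ^ 2 by ring,
        Real.sqrt_sq (by positivity)]
    rw [e, e']
    refine Real.sqrt_le_sqrt ?_
    have e2 : 2 * Λ / (α * d) = τ / M * (16 * Λ / α) := by rw [hd]; field_simp; ring
    rw [e2]
    have : τ / M ≤ τ ^ 4 := by
      rw [div_le_iff₀ hM0]
      have h5 : τ ≤ τ ^ 4 := le_self_pow₀ hτ (by norm_num)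
      nlinarith
    gcongr
  have h4 : 1 / d * (M / α * X * A) ≤ τ ^ 2 * (8 / α * (p₀ + 16 * β) * (A / ρ)) := by
    have e : 1 / d * (M / α * X * A) = 8 * τ / α * A * X := by rw [hd]; field_simp
    rw [e]
    refine (mul_le_mul_of_nonneg_left hXle (by positivity)).trans_eq ?_
    ring
  have h5 : 4 / (ρ / (4 * τ)) * A ≤ τ ^ 2 * (16 * (A / ρ)) := by
    have e : 4 / (ρ / (4 * τ)) * A = τ * (16 * (A / ρ)) := by field_simp; ring
    rw [e]
    gcongr
  have h6 : 1 / d * √(2 * d / α * (Λ * A ^ θ + M ^ 2 / (2 * α * d) * X ^ 2 * A) * A) ≤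
      1 / d * (√(2 * d / α * Λ) * Y + M / α * X * A) := by gcongr
  have h7 : 1 / d * √(2 * d / α * Λ) * Y ≤ τ ^ 2 * √(16 * Λ / α) * Y := by gcongr
  nlinarith

theorem superlevelVolume_anti {u : RN N → ℝ} {x₀ : RN N} {k k' r r' : ℝ} (hk : k ≤ k')
    (hr : r' ≤ r) : superlevelVolume u x₀ k' r' ≤ superlevelVolume u x₀ k r := by
  have : IsFiniteMeasure (volume.restrict (Metric.closedBall x₀ r)) :=
    ⟨by simpa using (isCompact_closedBall x₀ r).measure_lt_top⟩
  refine ENNReal.toReal_mono (measure_ne_top _ _) ?_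
  rw [Measure.restrict_apply' Metric.isClosed_closedBall.measurableSet,
    Measure.restrict_apply' Metric.isClosed_closedBall.measurableSet]
  exact measure_mono fun x hx => ⟨lt_of_le_of_lt hk hx.1, Metric.closedBall_subset_closedBall hr hx.2⟩

/-- The recursion has exponent `1 - 1/N` on the left and `(θ + 1)/2` on the right; the right one is
larger exactly because `θ > 1 - 2/N`. -/
theorem exists_degiorgi_const (hN : 2 ≤ N) {C α β p₀ Λ θ : ℝ} (hC : 0 < C) (hα : 0 < α)
    (hβ : 0 ≤ β) (hp₀ : 0 ≤ p₀) (hΛ : 0 ≤ Λ) (hθ : 1 - 2 / (N : ℝ) < θ) (hθ1 : θ ≤ 1) :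
    ∃ ε : ℝ, 0 < ε ∧ ∀ (u : RN N → ℝ) (x₀ : RN N) (M ρ : ℝ), 1 ≤ M → 0 < ρ → ρ ≤ 1 →
      (∀ k d r' r : ℝ, 0 ≤ k → 0 < d → 0 < r' → r' < r → r ≤ ρ →
        superlevelVolume u x₀ (k + d) r' ^ (1 - 1 / (N : ℝ)) ≤
        C * (1 / d * √(2 * d / α * (Λ * superlevelVolume u x₀ k r ^ θ +
          M ^ 2 / (2 * α * d) * (p₀ + 4 * β / (r - r')) ^ 2 * superlevelVolume u x₀ k r) *
            superlevelVolume u x₀ k r) + 4 / (r - r') * superlevelVolume u x₀ k r)) →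
      superlevelVolume u x₀ (M / 4) ρ ≤ ε * ρ ^ N → superlevelVolume u x₀ (M / 2) (ρ / 2) = 0 := by
  have hN2 : (2 : ℝ) ≤ N := by exact_mod_cast hN
  have hN0 : (0 : ℝ) < N := by linarith
  set p := 1 - 1 / (N : ℝ) with hp
  set s := (θ + 1) / 2 with hs
  have hp0 : 0 < p := by
    rw [hp, sub_pos, div_lt_one hN0]; linarith
  have hps : p < s := by
    have : 1 / (N : ℝ) = (2 / N) / 2 := by ring
    rw [hp, hs]; linarith
  have hθ0 : 0 ≤ θ := by
    have : 2 / (N : ℝ) ≤ 1 := by rw [div_le_one hN0]; exact hN2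
    linarith
  have hs1 : s ≤ 1 := by rw [hs]; linarith
  set c₁ := √(16 * Λ / α) with hc₁
  set c₂ := 8 / α * (p₀ + 16 * β) + 16 with hc₂
  have hc₁0 : 0 ≤ c₁ := Real.sqrt_nonneg _
  have hc₂0 : 0 < c₂ := by positivity
  obtain ⟨ε, hε, hdecay⟩ := exists_fast_geometric_const hp0 hps
    (show 0 < C * (c₁ + c₂) by positivity)
  refine ⟨ε, hε, fun u x₀ M ρ hM hρ hρ1 hrec h0 => ?_⟩
  have hρN : 0 < ρ ^ N := by positivity
  have hM0 : 0 < M := by linarith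
  -- Levels rise from `M/4` to `M/2` while radii shrink from `ρ` to `ρ/2`; dividing by `ρ^N` makes
  -- the recursion uniform in `ρ ≤ 1`.
  set y : ℕ → ℝ := fun j =>
    superlevelVolume u x₀ (M / 2 - M / (4 * 2 ^ j)) (ρ / 2 + ρ / (2 * 2 ^ j)) / ρ ^ N with hy
  have hy0 : ∀ j, 0 ≤ y j := fun j => div_nonneg (superlevelVolume_nonneg _ _ _ _) hρN.le
  have hlim : Tendsto y atTop (𝓝 0) := by
    refine hdecay y hy0 ?_ fun j hj => ?_
    · simp only [hy, pow_zero, mul_one]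
      rw [div_le_iff₀ hρN, show M / 2 - M / 4 = M / 4 by ring, add_halves]
      exact h0
    · set τ : ℝ := 2 ^ j with hτ
      have hτ1 : 1 ≤ τ := one_le_pow₀ one_le_two
      have hτ0 : 0 < τ := by linarith
      set A := superlevelVolume u x₀ (M / 2 - M / (4 * τ)) (ρ / 2 + ρ / (2 * τ)) with hA
      have hA0 : 0 ≤ A := superlevelVolume_nonneg _ _ _ _
      have hyA : y j = A / ρ ^ N := rfl
      have hAy : A = ρ ^ N * y j := by rw [hyA]; field_simp
      have e1 : M / 2 - M / (4 * 2 ^ (j + 1)) = M / 2 - M / (4 * τ) + M / (8 * τ) := by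
        rw [pow_succ, ← hτ]; field_simp; ring
      have e2 : ρ / 2 + ρ / (2 * τ) - (ρ / 2 + ρ / (2 * 2 ^ (j + 1))) = ρ / (4 * τ) := by
        rw [pow_succ, ← hτ]; field_simp; ring
      have hδ : 0 < ρ / (4 * τ) := by positivity
      have hk0 : 0 ≤ M / 2 - M / (4 * τ) := by
        rw [sub_nonneg]
        exact div_le_div_of_nonneg_left hM0.le (by norm_num) (by linarith)
      have hr : ρ / 2 + ρ / (2 * τ) ≤ ρ := by
        have : ρ / (2 * τ) ≤ ρ / 2 := div_le_div_of_nonneg_left hρ.le (by norm_num) (by linarith)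
        linarith
      have h := hrec (M / 2 - M / (4 * τ)) (M / (8 * τ)) (ρ / 2 + ρ / (2 * 2 ^ (j + 1)))
        (ρ / 2 + ρ / (2 * τ)) hk0 (by positivity) (by positivity) (by linarith) hr
      rw [← e1, e2, ← hA] at h
      set A' := superlevelVolume u x₀ (M / 2 - M / (4 * 2 ^ (j + 1)))
        (ρ / 2 + ρ / (2 * 2 ^ (j + 1))) with hA'
      have hA'0 : 0 ≤ A' := superlevelVolume_nonneg _ _ _ _
      have h2 := h.trans (mul_le_mul_of_nonneg_left
        (degiorgi_step_bound hα hβ hp₀ hΛ hM hρ hρ1 hτ1 hA0 hθ0) hC.le)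
      rw [← hc₁, ← hc₂, ← hs] at h2
      have hρp : (ρ ^ N) ^ p = ρ ^ N / ρ := by
        rw [← Real.rpow_natCast, ← Real.rpow_mul hρ.le, hp, mul_sub, mul_one,
          mul_one_div_cancel hN0.ne', Real.rpow_sub hρ, Real.rpow_one]
      have hρs : (ρ ^ N) ^ s ≤ ρ ^ N / ρ := by
        rw [← hρp]
        exact Real.rpow_le_rpow_of_exponent_ge hρN (pow_le_one₀ hρ.le hρ1) hps.le
      have hys : y j ≤ y j ^ s := by
        rcases (hy0 j).eq_or_lt with h3 | h3
        · rw [← h3]; exact Real.rpow_nonneg le_rfl _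
        · conv_lhs => rw [← Real.rpow_one (y j)]
          exact Real.rpow_le_rpow_of_exponent_ge h3 hj hs1
      have hys0 : 0 ≤ y j ^ s := Real.rpow_nonneg (hy0 j) _
      have h3 : c₁ * A ^ s + c₂ * (A / ρ) ≤ (c₁ + c₂) * (ρ ^ N / ρ * y j ^ s) := by
        have h4 : A ^ s ≤ ρ ^ N / ρ * y j ^ s := by
          rw [hAy, Real.mul_rpow hρN.le (hy0 j)]
          exact mul_le_mul_of_nonneg_right hρs hys0
        have h5 : A / ρ ≤ ρ ^ N / ρ * y j ^ s := by
          rw [hAy, mul_div_right_comm]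
          exact mul_le_mul_of_nonneg_left hys (by positivity)
        linarith [mul_le_mul_of_nonneg_left h4 hc₁0, mul_le_mul_of_nonneg_left h5 hc₂0.le]
      have h4 : τ ^ 2 = 4 ^ j := by rw [hτ, ← pow_mul, mul_comm, pow_mul]; norm_num
      have hy1 : y (j + 1) = A' / ρ ^ N := rfl
      rw [hy1, Real.div_rpow hA'0 hρN.le, hρp, div_le_iff₀ (by positivity)]
      refine h2.trans ((mul_le_mul_of_nonneg_left (mul_le_mul_of_nonneg_left h3 (sq_nonneg τ))
        hC.le).trans_eq ?_)
      rw [h4]; ring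
  have hle : ∀ j, superlevelVolume u x₀ (M / 2) (ρ / 2) ≤ ρ ^ N * y j := fun j => by
    have : ρ ^ N * y j =
        superlevelVolume u x₀ (M / 2 - M / (4 * 2 ^ j)) (ρ / 2 + ρ / (2 * 2 ^ j)) := by
      simp only [hy]; field_simp
    rw [this]
    have h1 : 0 ≤ M / (4 * 2 ^ j) := by positivity
    have h2 : 0 ≤ ρ / (2 * 2 ^ j) := by positivity
    exact superlevelVolume_anti (by linarith) (by linarith)
  have h := ge_of_tendsto' (hlim.const_mul (ρ ^ N)) hle
  rw [mul_zero] at h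
  exact le_antisymm h (superlevelVolume_nonneg _ _ _ _)

theorem superlevelVolume_le (u : RN N → ℝ) (x₀ : RN N) (k : ℝ) {r : ℝ} (hr : 0 ≤ r) :
    superlevelVolume u x₀ k r ≤ volume.real (Metric.ball (0 : RN N) 1) * r ^ N := by
  have h1 : superlevelVolume u x₀ k r ≤ volume.real (Metric.closedBall x₀ r) := by
    refine ENNReal.toReal_mono (isCompact_closedBall x₀ r).measure_lt_top.ne ?_
    exact (measure_mono (subset_univ _)).trans_eq (by simp)
  refine h1.trans_eq ?_
  rw [measureReal_def, Measure.addHaar_closedBall _ _ hr, ENNReal.toReal_mul,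
    ENNReal.toReal_ofReal (by positivity), mul_comm]
  simp [measureReal_def]

/-- If `u ≤ M` on a ball of radius `2ρ`, where `ρ` is large in comparison with the length scale
`√(M / b(M/8))` of the absorption term, then `u ≤ M / 2` on the ball of radius `ρ / 2`. -/
theorem exists_halving_const (hN : 2 ≤ N) {α β p₀ m Λ θ : ℝ} (hα : 0 < α)
    (hβ : 0 ≤ β) (hp₀ : 0 ≤ p₀) (hm : 0 < m) (hΛ : 0 ≤ Λ) (hθ : 1 - 2 / (N : ℝ) < θ)
    (hθ1 : θ ≤ 1) : ∃ C₁ : ℝ, 0 < C₁ ∧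
    ∀ {Ω : Opens (RN N)} {a : RN N → ℝ → RN N → RN N} {B : RN N → ℝ → ℝ} {F : RN N → RN N → ℝ}
      {u : RN N → ℝ} {Du : RN N → RN N} {F₀ : RN N → ℝ} {b : ℝ → ℝ} {x₀ : RN N} {M ρ : ℝ},
      IsDistribSubsolution Ω a B F u Du → MemH1Loc Ω u Du →
      MonotoneOn b (Ici 0) → (∀ s, 0 ≤ s → 0 ≤ b s) → 1 ≤ M → 0 < ρ → ρ ≤ 1 →
      Metric.closedBall x₀ (2 * ρ) ⊆ (Ω : Set (RN N)) →
      Integrable F₀ (volume.restrict (Metric.closedBall x₀ (2 * ρ))) →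
      (∀ᵐ x ∂volume.restrict (Metric.closedBall x₀ (2 * ρ)),
        StructureBounds a B F u Du α β p₀ m F₀ b x) →
      (∀ᵐ x ∂volume.restrict (Metric.closedBall x₀ (2 * ρ)), u x ≤ M) →
      (∀ k r, r ≤ 2 * ρ →
        (∫ x in {x | k < u x}, F₀ x ∂volume.restrict (Metric.closedBall x₀ r)) ≤
        Λ * superlevelVolume u x₀ k r ^ θ) →
      C₁ * M ≤ b (M / 8) * ρ ^ 2 →
      ∀ᵐ x ∂volume.restrict (Metric.closedBall x₀ (ρ / 2)), u x ≤ M / 2 := by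
  obtain ⟨C, hC, hlev⟩ := exists_level_set_const hN
  obtain ⟨ε, hε, hdg⟩ := exists_degiorgi_const hN hC hα hβ hp₀ hΛ hθ hθ1
  have hN2 : (2 : ℝ) ≤ N := by exact_mod_cast hN
  have hN0 : (0 : ℝ) < N := by linarith
  have hθ0 : 0 ≤ θ := by
    have : 2 / (N : ℝ) ≤ 1 := by rw [div_le_one hN0]; exact hN2
    linarith
  set v := volume.real (Metric.ball (0 : RN N) 1) * 2 ^ N with hv
  have hv0 : 0 ≤ v := mul_nonneg measureReal_nonneg (by positivity)
  set c := Λ * v ^ θ + 4 / α * (p₀ + 4 * β) ^ 2 * v with hc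
  have hc0 : 0 ≤ c := by positivity
  -- Chosen so that the absorption bound below becomes `|{u > M/4}| ≤ ε ρ^N`, the smallness that the
  -- iteration needs. The `+ 1` makes the constant positive, which later forces `b(M/8) > 0`.
  refine ⟨(c + 1) * Real.exp 3 / (ε * m), by positivity, ?_⟩
  intro Ω a B F u Du F₀ b x₀ M ρ hsub hu hb_mono hb hM hρ hρ1 hKΩ hF₀ hstr huM hF₀Λ hCM
  have hM0 : 0 < M := by linarith
  have hsubset : ∀ r, r ≤ 2 * ρ → Metric.closedBall x₀ r ⊆ Metric.closedBall x₀ (2 * ρ) :=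
    fun r hr => Metric.closedBall_subset_closedBall hr
  have hzero : superlevelVolume u x₀ (M / 2) (ρ / 2) = 0 := by
    refine hdg u x₀ M ρ hM hρ hρ1 (fun k d r' r hk hd hr' hr hrρ => ?_) ?_
    · have hr2 : r ≤ 2 * ρ := by linarith
      have hs := hsubset r hr2
      exact (hlev hsub hu hα hβ hp₀ hm.le hb_mono hb hr' hr (hs.trans hKΩ)
        (hF₀.mono_measure (Measure.restrict_mono_set _ hs))
        (ae_restrict_of_ae_restrict_of_subset hs hstr)
        (ae_restrict_of_ae_restrict_of_subset hs huM) hk hd (hF₀Λ k r hr2)).2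
    -- The absorption bound with `k = d = M/8`, between the balls of radius `2ρ` and `ρ`.
    · have h := (hlev hsub hu hα hβ hp₀ hm.le hb_mono hb hρ (by linarith : ρ < 2 * ρ) hKΩ hF₀ hstr
        huM (by positivity : 0 ≤ M / 8) (by positivity : 0 < M / 8) (hF₀Λ _ _ le_rfl)).1
      rw [show M / 8 + M / 8 = M / 4 by ring, show 2 * ρ - ρ = ρ by ring] at h
      set A := superlevelVolume u x₀ (M / 8) (2 * ρ) with hA
      have hA0 : 0 ≤ A := superlevelVolume_nonneg _ _ _ _
      have hAv : A ≤ v * ρ ^ N := by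
        refine (superlevelVolume_le u x₀ (M / 8) (by positivity : 0 ≤ 2 * ρ)).trans_eq ?_
        rw [hv, mul_pow]; ring
      have hρN : 0 < ρ ^ N := by positivity
      have h1 : Λ * A ^ θ ≤ Λ * v ^ θ * (ρ ^ N * (M / ρ ^ 2)) := by
        -- Since `Nθ > N - 2` and `ρ ≤ 1`, the contribution of `F₀` scales no worse than that of the
        -- cutoff.
        have h2 : (ρ ^ N) ^ θ ≤ ρ ^ N / ρ ^ 2 := by
          rw [← Real.rpow_natCast ρ N, ← Real.rpow_mul hρ.le, ← Real.rpow_natCast ρ 2,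
            ← Real.rpow_sub hρ]
          refine Real.rpow_le_rpow_of_exponent_ge hρ hρ1 ?_
          have h3 := mul_lt_mul_of_pos_left hθ hN0
          rw [mul_sub, mul_div_cancel₀ _ hN0.ne'] at h3
          push_cast; linarith
        have h3 : ρ ^ N / ρ ^ 2 ≤ ρ ^ N * (M / ρ ^ 2) := by
          rw [mul_div_assoc', mul_comm]
          exact div_le_div_of_nonneg_right (le_mul_of_one_le_left hρN.le hM) (sq_nonneg _)
        calc Λ * A ^ θ ≤ Λ * (v * ρ ^ N) ^ θ := by
              exact mul_le_mul_of_nonneg_left (Real.rpow_le_rpow hA0 hAv hθ0) hΛ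
          _ = Λ * v ^ θ * (ρ ^ N) ^ θ := by rw [Real.mul_rpow hv0 hρN.le]; ring
          _ ≤ _ := mul_le_mul_of_nonneg_left (h2.trans h3) (by positivity)
      have h2 : M ^ 2 / (2 * α * (M / 8)) * (p₀ + 4 * β / ρ) ^ 2 * A ≤
          4 / α * (p₀ + 4 * β) ^ 2 * v * (ρ ^ N * (M / ρ ^ 2)) := by
        have h3 : p₀ + 4 * β / ρ ≤ (p₀ + 4 * β) / ρ := by
          rw [add_div]
          have : p₀ ≤ p₀ / ρ := by rw [le_div_iff₀ hρ]; nlinarith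
          linarith
        have h4 : M ^ 2 / (2 * α * (M / 8)) = 4 * M / α := by field_simp; ring
        rw [h4]
        calc 4 * M / α * (p₀ + 4 * β / ρ) ^ 2 * A ≤
            4 * M / α * ((p₀ + 4 * β) / ρ) ^ 2 * (v * ρ ^ N) := by gcongr
          _ = _ := by rw [div_pow]; ring
      have h3 : m * b (M / 8) * (Real.exp (-3) * superlevelVolume u x₀ (M / 4) ρ) ≤
          (c + 1) * (ρ ^ N * (M / ρ ^ 2)) := by
        refine h.trans ((add_le_add h1 h2).trans ?_)
        rw [← add_mul, ← hc]
        exact mul_le_mul_of_nonneg_right (by linarith) (by positivity)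
      have hb0 : 0 < b (M / 8) := by
        by_contra hneg
        have h4 : b (M / 8) * ρ ^ 2 ≤ 0 :=
          mul_nonpos_of_nonpos_of_nonneg (not_lt.1 hneg) (sq_nonneg _)
        have h5 : 0 < (c + 1) * Real.exp 3 / (ε * m) * M := by positivity
        linarith
      have h4 : (c + 1) * M * Real.exp 3 ≤ ε * m * (b (M / 8) * ρ ^ 2) := by
        rw [div_mul_eq_mul_div, div_le_iff₀ (by positivity)] at hCM
        linarith
      have hexp : Real.exp 3 * Real.exp (-3) = 1 := by rw [← Real.exp_add]; norm_num
      have h5 : m * b (M / 8) * superlevelVolume u x₀ (M / 4) ρ ≤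
          m * b (M / 8) * (ε * ρ ^ N) := by
        calc m * b (M / 8) * superlevelVolume u x₀ (M / 4) ρ
            = Real.exp 3 * (m * b (M / 8) *
                (Real.exp (-3) * superlevelVolume u x₀ (M / 4) ρ)) := by
              rw [← one_mul (m * b (M / 8) * _), ← hexp]; ring
          _ ≤ Real.exp 3 * ((c + 1) * (ρ ^ N * (M / ρ ^ 2))) := by gcongr
          _ = (c + 1) * M * Real.exp 3 * (ρ ^ N / ρ ^ 2) := by ring
          _ ≤ ε * m * (b (M / 8) * ρ ^ 2) * (ρ ^ N / ρ ^ 2) := by gcongr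
          _ = m * b (M / 8) * (ε * ρ ^ N) := by field_simp
      exact le_of_mul_le_mul_left h5 (by positivity)
  have : IsFiniteMeasure (volume.restrict (Metric.closedBall x₀ (ρ / 2))) :=
    ⟨by simpa using (isCompact_closedBall x₀ (ρ / 2)).measure_lt_top⟩
  rw [superlevelVolume, measureReal_eq_zero_iff] at hzero
  rw [ae_iff]
  simpa only [not_le] using hzero

/-! ### The Keller-Osserman condition on dyadic scales. -/

/-- Monotonicity gives `∫_0^t b ≤ t b(t)`. On `(T, 2T]` the integrand is therefore at least `1/√(4T
b(2T))`, so this piece of the convergent integral dominates a multiple of `√(2T / b(2T))`. -/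
theorem KellerOsserman.summable {b : ℝ → ℝ} (hb_cont : ContinuousOn b (Ici 0))
    (hb_nonneg : ∀ s, 0 ≤ s → 0 ≤ b s) (hb_mono : MonotoneOn b (Ici 0)) (hb : KellerOsserman b) :
    (∀ᶠ n : ℕ in atTop, 0 < b (2 ^ n)) ∧ Summable fun n : ℕ => √(2 ^ n / b (2 ^ n)) := by
  obtain ⟨t₀, ht₀, hpos, hint⟩ := hb
  have hbi : ∀ s t, 0 ≤ s → 0 ≤ t → IntervalIntegrable b volume s t := fun s t hs ht =>
    (hb_cont.mono fun x hx => (le_min hs ht).trans hx.1).intervalIntegrable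
  have hle : ∀ t, 0 ≤ t → ∫ s in (0 : ℝ)..t, b s ≤ t * b t := fun t ht => by
    have h := intervalIntegral.integral_mono_on ht (hbi 0 t le_rfl ht)
      (intervalIntegrable_const (c := b t)) fun x hx => hb_mono hx.1 ht hx.2
    simpa using h
  have hPmono : ∀ s t, 0 ≤ s → s ≤ t → ∫ x in (0 : ℝ)..s, b x ≤ ∫ x in (0 : ℝ)..t, b x := by
    intro s t hs hst
    rw [← intervalIntegral.integral_add_adjacent_intervals (hbi 0 s le_rfl hs)
      (hbi s t hs (hs.trans hst))]
    exact le_add_of_nonneg_right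
      (intervalIntegral.integral_nonneg hst fun x hx => hb_nonneg x (hs.trans hx.1))
  have hbpos : ∀ t, t₀ ≤ t → 0 < b t := fun t ht => by
    have ht' : 0 < t := ht₀.trans_le ht
    exact pos_of_mul_pos_right ((hpos t ht).trans_le (hle t ht'.le)) ht'.le
  obtain ⟨n₀, hn₀⟩ := pow_unbounded_of_one_lt t₀ (one_lt_two (α := ℝ))
  have hge : ∀ n, t₀ ≤ (2 : ℝ) ^ (n + n₀) := fun n => hn₀.le.trans
    (pow_le_pow_right₀ one_le_two (Nat.le_add_left _ _))
  refine ⟨eventually_atTop.2 ⟨n₀, fun n hn => hbpos _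
    (hn₀.le.trans (pow_le_pow_right₀ one_le_two hn))⟩, ?_⟩
  set f : ℝ → ℝ := fun t => 1 / √(2 * ∫ s in (0 : ℝ)..t, b s) with hf
  set I : ℕ → Set ℝ := fun n => Ioc (2 ^ (n + n₀)) (2 ^ (n + n₀ + 1)) with hI
  have hIsub : ∀ n, I n ⊆ Ioi t₀ := fun n x hx => (hge n).trans_lt hx.1
  have hdisj : Pairwise (Function.onFun Disjoint I) := by
    have hm : Monotone fun n : ℕ => (2 : ℝ) ^ (n + n₀) := fun i j hij =>
      pow_le_pow_right₀ one_le_two (by omega)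
    have := hm.pairwise_disjoint_on_Ioc_succ
    simpa [I, Nat.succ_eq_add_one, add_right_comm] using this
  have hsum : Summable fun n => ∫ t in I n, f t :=
    (hasSum_integral_iUnion (fun n => measurableSet_Ioc) hdisj
      (hint.mono_set (iUnion_subset hIsub))).summable
  -- The `n`-th dyadic interval controls the term at its right endpoint, whence the shift by `n₀ +
  -- 1` rather than `n₀`.
  rw [← summable_nat_add_iff (n₀ + 1)]
  refine Summable.of_nonneg_of_le (fun n => Real.sqrt_nonneg _) (fun n => ?_) (hsum.mul_left 4)
  set T : ℝ := 2 ^ (n + n₀) with hT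
  have hT0 : 0 < T := by positivity
  have e1 : (2 : ℝ) ^ (n + (n₀ + 1)) = 2 * T := by rw [hT, ← add_assoc, pow_succ]; ring
  have e2 : (2 : ℝ) ^ (n + n₀ + 1) = 2 * T := by rw [hT, pow_succ]; ring
  rw [e1]
  have hTt : t₀ ≤ 2 * T := (hge n).trans (by linarith)
  have hb2 : 0 < b (2 * T) := hbpos _ hTt
  have hlow : ∀ t ∈ I n, 1 / √(2 * (2 * T * b (2 * T))) ≤ f t := by
    intro t ht
    have ht1 : T < t := ht.1
    have ht2 : t ≤ 2 * T := e2 ▸ ht.2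
    refine one_div_le_one_div_of_le (Real.sqrt_pos.2 (mul_pos two_pos (hpos t ?_)))
      (Real.sqrt_le_sqrt ?_)
    · exact (hge n).trans ht1.le
    · have := (hPmono t (2 * T) (by linarith) ht2).trans (hle (2 * T) (by positivity))
      linarith
  have h1 : ∫ t in I n, 1 / √(2 * (2 * T * b (2 * T))) ≤ ∫ t in I n, f t := by
    refine setIntegral_mono_on ?_ (hint.mono_set (hIsub n)) measurableSet_Ioc hlow
    exact integrableOn_const (by simp [I])
  have h2 : ∫ t in I n, 1 / √(2 * (2 * T * b (2 * T))) = T * (1 / √(2 * (2 * T * b (2 * T)))) := by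
    have e3 : I n = Ioc T (2 * T) := by rw [← e2]
    rw [setIntegral_const, e3, measureReal_def, Real.volume_Ioc,
      ENNReal.toReal_ofReal (by linarith), smul_eq_mul]
    ring
  have h3 : √(2 * T / b (2 * T)) ≤ 4 * (T * (1 / √(2 * (2 * T * b (2 * T))))) := by
    have e3 : 4 * (T * (1 / √(2 * (2 * T * b (2 * T))))) = √(4 * T / b (2 * T)) := by
      rw [show 4 * T / b (2 * T) = (4 * T) ^ 2 / (2 * (2 * T * b (2 * T))) by field_simp; ring,
        Real.sqrt_div (sq_nonneg _), Real.sqrt_sq (by positivity)]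
      ring
    rw [e3]
    exact Real.sqrt_le_sqrt (div_le_div_of_nonneg_right (by linarith) hb2.le)
  rw [h2] at h1
  linarith

end

/-! ### Hölder's inequality for the datum, and localization to balls. -/

section

open Filter Topology

variable {N : ℕ}

/-- Hölder's inequality. For `q = ∞` the conventions `∞.toReal = 0` and `1 / 0 = 0` give the correct
exponent `1`. -/
theorem MeasureTheory.MemLp.setIntegral_le_mul_rpow {X : Type*} [MeasurableSpace X] {μ ν : Measure X}
    [IsFiniteMeasure ν] {f : X → ℝ} {q : ℝ≥0∞} (hf : MemLp f q μ) (hq : 1 ≤ q) (hνμ : ν ≤ μ)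
    (S : Set X) :
    ∫ x in S, f x ∂ν ≤ (eLpNorm f q μ).toReal * ν.real S ^ (1 - 1 / q.toReal) := by
  have hle : ν.restrict S ≤ μ := Measure.restrict_le_self.trans hνμ
  have hfS : MemLp f q (ν.restrict S) := hf.mono_measure hle
  have hθ : 0 ≤ 1 - 1 / q.toReal := by
    rw [sub_nonneg]
    rcases eq_or_ne q ∞ with h | h
    · simp [h]
    · have h1 : 1 ≤ q.toReal := by
        simpa using ENNReal.toReal_mono h hq
      exact (div_le_one (by linarith)).2 h1
  have h1 := eLpNorm_le_eLpNorm_mul_rpow_measure_univ hq hfS.1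
  rw [Measure.restrict_apply_univ, ENNReal.toReal_one, div_one] at h1
  have hfin : eLpNorm f q μ * ν S ^ (1 - 1 / q.toReal) ≠ ∞ :=
    ENNReal.mul_ne_top hf.2.ne (ENNReal.rpow_ne_top_of_nonneg hθ (measure_ne_top _ _))
  have h2 : eLpNorm f 1 (ν.restrict S) ≤ eLpNorm f q μ * ν S ^ (1 - 1 / q.toReal) :=
    h1.trans (mul_le_mul_left (eLpNorm_mono_measure f hle) _)
  have h3 : ∫ x in S, f x ∂ν ≤ (eLpNorm f 1 (ν.restrict S)).toReal := by
    rw [eLpNorm_one_eq_lintegral_enorm, ← integral_norm_eq_lintegral_enorm hfS.1]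
    exact (le_abs_self _).trans (norm_integral_le_integral_norm f)
  refine h3.trans ((ENNReal.toReal_mono hfin h2).trans_eq ?_)
  rw [ENNReal.toReal_mul, ← ENNReal.toReal_rpow]
  rfl

theorem ae_restrict_of_forall_closedBall {s : Set (RN N)} (hs : MeasurableSet s) {r : ℝ}
    (hr : 0 < r) {P : RN N → Prop}
    (h : ∀ x ∈ s, ∀ᵐ y ∂volume.restrict (Metric.closedBall x r), P y) :
    ∀ᵐ y ∂volume.restrict s, P y := by
  rw [ae_iff, Measure.restrict_apply' hs]
  refine measure_null_of_locally_null _ fun x hx => ?_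
  refine ⟨({y | ¬ P y} ∩ s) ∩ Metric.closedBall x r,
    inter_mem self_mem_nhdsWithin (mem_nhdsWithin_of_mem_nhds (Metric.closedBall_mem_nhds x hr)), ?_⟩
  have h1 := h x hx.2
  rw [ae_iff, Measure.restrict_apply' Metric.isClosed_closedBall.measurableSet] at h1
  exact measure_mono_null (inter_subset_inter_left _ inter_subset_left) h1

end

/-! ### Descent through the dyadic levels. -/

theorem mainTheorem8 (N : ℕ) (hN : 2 ≤ N) (Ω : Opens (RN N))
    (a : RN N → ℝ → RN N → RN N) (B : RN N → ℝ → ℝ) (F : RN N → RN N → ℝ)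
    (ha_car : IsCaratheodory Ω (fun x (p : ℝ × RN N) => a x p.1 p.2))
    (hB_car : IsCaratheodory Ω B) (hF_car : IsCaratheodory Ω F)
    (α β : ℝ) (hα : 0 < α) (hαβ : α ≤ β)
    (ha_coercive : ∀ᵐ x ∂(volume.restrict (Ω : Set (RN N))), ∀ (s : ℝ) (ξ : RN N),
      α * ‖ξ‖ ^ 2 ≤ inner ℝ (a x s ξ) ξ)
    (ha_bounded : ∀ᵐ x ∂(volume.restrict (Ω : Set (RN N))), ∀ (s : ℝ) (ξ : RN N),
      ‖a x s ξ‖ ≤ β * ‖ξ‖)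
    (ha_monotone : ∀ᵐ x ∂(volume.restrict (Ω : Set (RN N))), ∀ (s : ℝ) (ξ η : RN N), ξ ≠ η →
      0 < inner ℝ (a x s ξ - a x s η) (ξ - η))
    (q : ℝ≥0∞) (hq : (N : ℝ≥0∞) / 2 < q) (F₀ : RN N → ℝ) (hF₀ : MemLpLoc Ω F₀ q)
    (p₀ : ℝ) (hp₀ : 0 < p₀)
    (hF : ∀ᵐ x ∂(volume.restrict (Ω : Set (RN N))), ∀ ξ : RN N, |F x ξ| ≤ F₀ x + p₀ * ‖ξ‖)
    (b : ℝ → ℝ) (hb_cont : ContinuousOn b (Ici 0)) (hb_nonneg : ∀ s, 0 ≤ s → 0 ≤ b s)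
    (hb_mono : MonotoneOn b (Ici 0)) (hb_KO : KellerOsserman b)
    (hb_div : ∃ s₀ : ℝ, 0 < s₀ ∧ MonotoneOn (fun s => b s / s) (Ici s₀))
    (hB : ∀ ω : Set (RN N), CompactlyContained ω Ω → ∃ m : ℝ, 0 < m ∧
      ∀ᵐ x ∂(volume : Measure (RN N)), x ∈ ω → ∀ s : ℝ, 0 < s → m * b s ≤ B x s) :
    ∀ ω : Set (RN N), CompactlyContained ω Ω → ∃ C : ℝ, 0 < C ∧
      ∀ (u : RN N → ℝ) (Du : RN N → RN N), MemH1Loc Ω u Du →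
        IsDistribSubsolution Ω a B F u Du →
        MemLpLoc Ω (fun x => max (u x) 0) ∞ →
        MemLpLoc Ω (fun x => B x (max (u x) 0)) 1 →
        ∀ᵐ x ∂(volume : Measure (RN N)), x ∈ ω → u x ≤ C := by
  intro ω hω
  obtain ⟨δ, hδ, hδΩ⟩ := hω.1.exists_cthickening_subset_open Ω.isOpen hω.2
  -- `R` is the total distance that the halvings may consume; `R ≤ 1` ensures that every radius used
  -- is at most `1`.
  set R := min δ 1 with hR
  have hR0 : 0 < R := lt_min hδ one_pos
  set K := Metric.cthickening R (closure ω) with hK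
  have hKc : IsCompact K := hω.1.cthickening
  have hKΩ : K ⊆ (Ω : Set (RN N)) :=
    (Metric.cthickening_mono (min_le_left _ _) _).trans hδΩ
  obtain ⟨m, hm, hBm⟩ := hB K (by rw [CompactlyContained, hKc.isClosed.closure_eq]; exact ⟨hKc, hKΩ⟩)
  have hN2 : (2 : ℝ) ≤ N := by exact_mod_cast hN
  have hN0 : (0 : ℝ) < N := by linarith
  have hq1 : 1 ≤ q := by
    refine le_trans ?_ hq.le
    rw [ENNReal.le_div_iff_mul_le (by simp) (by simp), one_mul]
    exact_mod_cast hN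
  have hθ : 1 - 2 / (N : ℝ) < 1 - 1 / q.toReal := by
    have : 1 / q.toReal < 2 / N := by
      rcases eq_or_ne q ∞ with h | h
      · rw [h, ENNReal.toReal_top, div_zero]; positivity
      · have h1 : (N : ℝ) / 2 < q.toReal := by
          have := (ENNReal.toReal_lt_toReal hq.ne_top h).2 hq
          simpa using this
        rw [div_lt_div_iff₀ (by linarith) hN0]
        linarith
    linarith
  have hθ1 : 1 - 1 / q.toReal ≤ 1 := by
    have : 0 ≤ 1 / q.toReal := by positivity
    linarith
  have hF₀K := hF₀ K hKc hKΩ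
  have : IsFiniteMeasure (volume.restrict K) := ⟨by simpa using hKc.measure_lt_top⟩
  have hF₀i : Integrable F₀ (volume.restrict K) := hF₀K.integrable hq1
  obtain ⟨C₁, hC₁, hhalf⟩ := exists_halving_const hN (Λ := (eLpNorm F₀ q (volume.restrict K)).toReal)
    hα (hα.le.trans hαβ) hp₀.le hm ENNReal.toReal_nonneg hθ hθ1
  obtain ⟨hbpos, hsum⟩ := hb_KO.summable hb_cont hb_nonneg hb_mono
  -- For `M = 8 · 2^n` the critical radius, with `C₁ M = b(M/8) ρ²`, is `√(8 C₁ 2^n / b(2^n))`; `σ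
  -- n` is twice this radius.
  set σ : ℕ → ℝ := fun n => 2 * (√(8 * C₁) * √(2 ^ n / b (2 ^ n))) with hσ
  have hσsum : Summable σ := (hsum.mul_left _).mul_left _
  obtain ⟨n₀, hn₀pos, hn₀⟩ := ((Filter.eventually_forall_ge_atTop.2 hbpos).and
    ((tendsto_sum_nat_add σ).eventually_lt_const hR0)).exists
  set ρ : ℕ → ℝ := fun k => √(8 * C₁) * √(2 ^ (k + n₀) / b (2 ^ (k + n₀))) with hρ
  have hbk : ∀ k, 0 < b (2 ^ (k + n₀)) := fun k => hn₀pos _ (Nat.le_add_left _ _)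
  have hρ0 : ∀ k, 0 < ρ k := fun k => by
    have := hbk k
    simp only [hρ]; positivity
  set r : ℕ → ℝ := fun k => ∑ i ∈ Finset.range k, 2 * ρ i with hr
  have hr0 : ∀ k, 0 ≤ r k := fun k => Finset.sum_nonneg fun i _ => by linarith [hρ0 i]
  have hrR : ∀ k, r k ≤ R := fun k =>
    (((summable_nat_add_iff n₀).2 hσsum).sum_le_tsum (Finset.range k)
      fun i _ => by positivity).trans hn₀.le
  have hrs : ∀ k, r (k + 1) = r k + 2 * ρ k := fun k => Finset.sum_range_succ _ _
  refine ⟨4 * 2 ^ n₀, by positivity, fun u Du hu hsub hu_top _ => ?_⟩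
  have hstr : ∀ᵐ x ∂volume.restrict K, StructureBounds a B F u Du α β p₀ m F₀ b x := by
    filter_upwards [ae_restrict_of_ae_restrict_of_subset hKΩ ha_coercive,
      ae_restrict_of_ae_restrict_of_subset hKΩ ha_bounded,
      ae_restrict_of_ae_restrict_of_subset hKΩ hF, ae_restrict_of_ae hBm,
      ae_restrict_mem hKc.measurableSet] with x h1 h2 h3 h4 hx
    refine ⟨h1 _ _, h2 _ _, h3 _, ?_, h4 hx⟩
    -- The growth bound at `ξ = 0` shows `F₀ x ≥ 0`.
    have := (abs_nonneg _).trans (h3 0)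
    simpa using this
  set E : ℕ → Set (RN N) := fun k => Metric.cthickening (r k) (closure ω) with hE
  have hEK : ∀ k, E k ⊆ K := fun k => Metric.cthickening_mono (hrR k) _
  -- Balls of radius `2 ρ k` centred in `E k` stay in `E (k + 1)`, so halving on each of them with
  -- `M = 8 · 2^(k + n₀)` gives the bound near every point of `E k`.
  have hstep : ∀ k, (∀ᵐ x ∂volume.restrict (E (k + 1)), u x ≤ 4 * 2 ^ (k + 1 + n₀)) →
      ∀ᵐ x ∂volume.restrict (E k), u x ≤ 4 * 2 ^ (k + n₀) := by
    intro k hk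
    refine ae_restrict_of_forall_closedBall Metric.isClosed_cthickening.measurableSet
      (half_pos (hρ0 k)) fun x hx => ?_
    have hball : Metric.closedBall x (2 * ρ k) ⊆ E (k + 1) := by
      refine (Metric.closedBall_subset_cthickening hx _).trans ?_
      have := Metric.cthickening_cthickening_subset (by linarith [hρ0 k] : 0 ≤ 2 * ρ k) (hr0 k)
        (closure ω)
      simp only [hE, hrs]
      rwa [add_comm (r k)]
    have hballK := hball.trans (hEK _)
    have e1 : (8 : ℝ) * 2 ^ (k + n₀) / 8 = 2 ^ (k + n₀) := by ring
    have e2 : (4 : ℝ) * 2 ^ (k + 1 + n₀) = 8 * 2 ^ (k + n₀) := by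
      rw [add_right_comm, pow_succ]; ring
    have e3 : (4 : ℝ) * 2 ^ (k + n₀) = 8 * 2 ^ (k + n₀) / 2 := by ring
    have h2n : (1 : ℝ) ≤ 2 ^ (k + n₀) := one_le_pow₀ one_le_two
    have hρ1 : ρ k ≤ 1 := by
      have h1 := hrR (k + 1)
      have h2 : R ≤ 1 := min_le_right _ _
      linarith [hrs k, hr0 k, hρ0 k]
    rw [e2] at hk
    rw [e3]
    refine hhalf hsub hu hb_mono hb_nonneg (by linarith) (hρ0 k) hρ1 (hballK.trans hKΩ)
      (hF₀i.mono_measure (Measure.restrict_mono_set _ hballK))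
      (ae_restrict_of_ae_restrict_of_subset hballK hstr)
      (ae_restrict_of_ae_restrict_of_subset hball hk) (fun l r' hr' => ?_) ?_
    · have hsubK : Metric.closedBall x r' ⊆ K :=
        (Metric.closedBall_subset_closedBall hr').trans hballK
      have : IsFiniteMeasure (volume.restrict (Metric.closedBall x r')) :=
        ⟨by simpa using (isCompact_closedBall x r').measure_lt_top⟩
      exact hF₀K.setIntegral_le_mul_rpow hq1 (Measure.restrict_mono_set _ hsubK) _
    · rw [e1]
      have := hbk k
      simp only [hρ]
      rw [mul_pow, Real.sq_sqrt (by positivity), Real.sq_sqrt (by positivity)]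
      refine le_of_eq ?_
      field_simp
  have hdescend : ∀ k, (∀ᵐ x ∂volume.restrict (E k), u x ≤ 4 * 2 ^ (k + n₀)) →
      ∀ᵐ x ∂volume.restrict (E 0), u x ≤ 4 * 2 ^ n₀ := by
    intro k
    induction k with
    | zero => intro h; simpa using h
    | succ k ih => exact fun h => ih (hstep k h)
  have htop := hu_top K hKc hKΩ
  -- Local boundedness of `u⁺` serves only to start the descent at some level `k`; the final bound
  -- does not see `c` or `k`.
  set c := (eLpNormEssSup (fun x => max (u x) 0) (volume.restrict K)).toReal with hc
  have huc : ∀ᵐ x ∂volume.restrict K, u x ≤ c := by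
    have hfin : eLpNormEssSup (fun x => max (u x) 0) (volume.restrict K) ≠ ∞ := by
      rw [← eLpNorm_exponent_top]; exact htop.2.ne
    filter_upwards [enorm_ae_le_eLpNormEssSup (fun x => max (u x) 0) (volume.restrict K)] with x hx
    have h1 := ENNReal.toReal_mono hfin hx
    rw [toReal_enorm] at h1
    exact (le_max_left _ _).trans ((le_abs_self _).trans h1)
  obtain ⟨k, hk⟩ := pow_unbounded_of_one_lt c (one_lt_two (α := ℝ))
  have hfinal := hdescend k (by
    filter_upwards [ae_restrict_of_ae_restrict_of_subset (hEK k) huc] with x hx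
    have h1 : (2 : ℝ) ^ k ≤ 2 ^ (k + n₀) := pow_le_pow_right₀ one_le_two (Nat.le_add_right _ _)
    have h2 : (0 : ℝ) < 2 ^ (k + n₀) := by positivity
    linarith)
  have hE0 : MeasurableSet (E 0) := Metric.isClosed_cthickening.measurableSet
  filter_upwards [(ae_restrict_iff' hE0).1 hfinal] with x hx hxω
  exact hx (Metric.self_subset_cthickening _ (subset_closure hxω))
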